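/- For complex parameters write $${}_3F_2\!\left({a_1,a_2,a_3\atop b_1,b_2}\Big|\,z\right)=\sum_{n\ge0}\frac{(a_1)_n(a_2)_n(a_3)_n}{(b_1)_n(b_2)_n\,n!}\,z^n .$$ Let $$\Psi_4=\frac{x\,(2x^2-21x+56)^2(x^2-28)^4(x^2-7x+14)^4}{4\,(x^3-14x^2+56x-56)^7},$$ $$P_4=1-x+\tfrac14x^2-\tfrac1{56}x^3,\qquad Q_4=\bigl(1-\tfrac1{28}x^2\bigr)\bigl(1-\tfrac12x+\tfrac1{14}x^2\bigr),$$ $$R_1=1-\tfrac38x+\tfrac1{28}x^2,\qquad R_2=1-\tfrac{33}{32}x+\tfrac{13}{32}x^2-\tfrac9{128}x^3+\tfrac1{224}x^4,$$ $$K_1=\Bigl(\tfrac12\sqrt{R_1R_2}+\tfrac12-\tfrac{45}{128}x+\tfrac5{64}x^2-\tfrac5{896}x^3\Bigr)^{1/4},\qquad K_2=\left(\frac{\sqrt{R_1R_2}-1+\frac{45}{64}x-\frac5{32}x^2+\frac5{448}x^3}{\frac{625}{57344}\,x^2}\right)^{1/4},$$ where here and below all roots and fractional powers are principal branches. Near $x=0$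 their bases are close to $1$ (the base of $K_2$ has a removable singularity at $x=0$, with value $1$ there), so $K_1$ and $K_2$ are $1+O(x)$. (a) The functions $${}_3F_2\!\left({-\frac3{28},\frac1{28},\frac9{28}\atop\frac14,\,\frac12}\Big|z\right),\quad z^{1/2}\,{}_3F_2\!\left({\frac{11}{28},\frac{15}{28},\frac{23}{28}\atop\frac34,\,\frac32}\Big|z\right),\quad z^{3/4}\,{}_3F_2\!\left({\frac9{14},\frac{11}{14},\frac{15}{14}\atop\frac54,\,\frac74}\Big|z\right)$$ are holomorphic solutions, on the unit disc cut along $(-1,0]$, of the same hypergeometric equation $$\Bigl(z\tfrac{d}{dz}+\alpha_1\Bigr)\Bigl(z\tfrac{d}{dz}+\alpha_2\Bigr)\Bigl(z\tfrac{d}{dz}+\alpha_3\Bigr)Y=\tfrac{d}{dz}\Bigl(z\tfrac{d}{dz}+\beta_1-1\Bigr)\Bigl(z\tfrac{d}{dz}+\beta_2-1\Bigr)Y$$ with $(\alpha_1,\alpha_2,\alpha_3)=(-\frac3{28},\frac1{28},\frac9{28})$ and $(\beta_1,\beta_2)=(\frac14,\frac12)$; that is, the three ${}_3F_2$-functions are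 companions. Moreover the parameter systems $(\frac9{14},\frac{11}{14},\frac{15}{14};\frac54,\frac74)$ and $(\frac1{14},\frac9{14},\frac{11}{14};\frac34,\frac54)$ are contiguous to $(-\frac3{14},\frac1{14},\frac9{14};\frac14,\frac34)$: after reordering the upper and the lower parameters, corresponding parameters differ by integers. (b) The following identities hold for all complex $x$ in a neighborhood of $0$ (in the second one, for $x\neq0$; there the right-hand side has a removable singularity at $x=0$): $${}_3F_2\!\left({-\frac3{28},\frac1{28},\frac9{28}\atop\frac14,\,\frac12}\Big|\Psi_4\right)=\frac{\frac12\sqrt{R_1R_2}+\frac12-\frac{15}{32}x+\frac{53}{448}x^2-\frac1{112}x^3}{P_4^{3/4}K_1},$$ $${}_3F_2\!\left({\frac{11}{28},\frac{15}{28},\frac{23}{28}\atop\frac34,\,\frac32}\Big|\Psi_4\right)=\frac{P_4^{11/4}}{Q_4^2R_1}\cdot\frac{\sqrt{R_1R_2}-1+\frac{15}{16}x-\frac{53}{224}x^2+\frac1{56}x^3}{\frac{15}{64}\,x\,K_2},$$ $${}_3F_2\!\left({\frac9{14},\frac{11}{14},\frac{15}{14}\atop\frac54,\,\frac74}\Big|\Psi_4\right)=\frac{P_4^{9/2}}{Q_4^3R_1^{3/2}}\Bigl(1-\tfrac3{14}x\Bigr),$$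 $${}_3F_2\!\left({\frac1{14},\frac9{14},\frac{11}{14}\atop\frac34,\,\frac54}\Big|\Psi_4\right)=\frac{\sqrt{P_4}}{Q_4\sqrt{R_1}}\Bigl(1-\tfrac35x+\tfrac18x^2-\tfrac1{112}x^3\Bigr),$$ $${}_3F_2\!\left({-\frac3{14},\frac1{14},\frac9{14}\atop\frac14,\,\frac34}\Big|\Psi_4\right)=\frac{\sqrt{R_1}}{P_4^{3/2}}\Bigl(1-\tfrac34x+\tfrac14x^2-\tfrac3{112}x^3\Bigr).$$ -/

import Mathlib

open Filter Topology

noncomputable section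

namespace HypergeometricDarboux

/-- The generalized hypergeometric function `₃F₂(a₀, a₁, a₂; b₀, b₁ | z)`, as the sum of its defining
power series `∑ (a₀)ₙ (a₁)ₙ (a₂)ₙ / ((b₀)ₙ (b₁)ₙ n!) zⁿ`, where `(c)ₙ = c (c+1) ⋯ (c+n-1)`. -/
def hyp3F2 (a : Fin 3 → ℂ) (b : Fin 2 → ℂ) (z : ℂ) : ℂ :=
  ∑' n : ℕ, (∏ i, (ascPochhammer ℂ n).eval (a i)) /
    ((∏ j, (ascPochhammer ℂ n).eval (b j)) * (n.factorial : ℂ)) * z ^ n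

/-- The operator `z d/dz + c`. -/
def eulerOp (c : ℂ) (y : ℂ → ℂ) : ℂ → ℂ := fun z => z * deriv y z + c * y z

/-- `y` is a holomorphic solution on the open set `U` of the third order hypergeometric equation
`(z d/dz + a₀)(z d/dz + a₁)(z d/dz + a₂) y = d/dz (z d/dz + b₀ - 1)(z d/dz + b₁ - 1) y`. -/
def IsHypSolutionOn (a : Fin 3 → ℂ) (b : Fin 2 → ℂ) (U : Set ℂ) (y : ℂ → ℂ) : Prop :=
  DifferentiableOn ℂ y U ∧
    ∀ z ∈ U, eulerOp (a 0) (eulerOp (a 1) (eulerOp (a 2) y)) z =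
      deriv (eulerOp (b 0 - 1) (eulerOp (b 1 - 1) y)) z

/-- The open unit disc cut along `(-1, 0]`. -/
def slitDisc : Set ℂ := {z | ‖z‖ < 1 ∧ z ∈ Complex.slitPlane}

/-- Two parameter systems of `₃F₂` are contiguous: up to the order of the upper parameters and the
order of the lower parameters, corresponding parameters differ by integers. -/
def Contiguous (a : Fin 3 → ℂ) (b : Fin 2 → ℂ) (a' : Fin 3 → ℂ) (b' : Fin 2 → ℂ) : Prop :=
  (∃ σ : Equiv.Perm (Fin 3), ∀ i, ∃ m : ℤ, a' (σ i) = a i + m) ∧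
    (∃ τ : Equiv.Perm (Fin 2), ∀ j, ∃ m : ℤ, b' (τ j) = b j + m)

/-- The degree 21 covering `Ψ₄`. -/
def Psi₄ (x : ℂ) : ℂ :=
  x * (2 * x ^ 2 - 21 * x + 56) ^ 2 * (x ^ 2 - 28) ^ 4 * (x ^ 2 - 7 * x + 14) ^ 4 /
    (4 * (x ^ 3 - 14 * x ^ 2 + 56 * x - 56) ^ 7)

def P₄ (x : ℂ) : ℂ := 1 - x + 1 / 4 * x ^ 2 - 1 / 56 * x ^ 3

def Q₄ (x : ℂ) : ℂ := (1 - 1 / 28 * x ^ 2) * (1 - 1 / 2 * x + 1 / 14 * x ^ 2)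

def R₁ (x : ℂ) : ℂ := 1 - 3 / 8 * x + 1 / 28 * x ^ 2

def R₂ (x : ℂ) : ℂ :=
  1 - 33 / 32 * x + 13 / 32 * x ^ 2 - 9 / 128 * x ^ 3 + 1 / 224 * x ^ 4

/-- `√(R₁ R₂)`: the principal square root, which is the branch with value `1` at `x = 0`. -/
def sqrtR (x : ℂ) : ℂ := (R₁ x * R₂ x) ^ (1 / 2 : ℂ)

/-- The base of the fourth root is `1` at `x = 0`, so near `0` this is the branch `1 + O(x)`. -/
def K₁ (x : ℂ) : ℂ :=
  (1 / 2 * sqrtR x + 1 / 2 - 45 / 128 * x + 5 / 64 * x ^ 2 - 5 / 896 * x ^ 3) ^ (1 / 4 : ℂ)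

/-- The base of the fourth root has a removable singularity at `x = 0` with limit `1`, so on a
punctured neighborhood of `0` this is the branch `1 + O(x)`; the formula is meant for `x ≠ 0`. -/
def K₂ (x : ℂ) : ℂ :=
  ((sqrtR x - 1 + 45 / 64 * x - 5 / 32 * x ^ 2 + 5 / 448 * x ^ 3) /
    (625 / 57344 * x ^ 2)) ^ (1 / 4 : ℂ)

end HypergeometricDarboux

end

open HypergeometricDarboux

noncomputable section

namespace HypergeometricDarboux

/-! Write θ = z d/dz. The contiguous functions F₀ = ₃F₂(a₁, a₂, a₃; c₁, c₂), F₁ (a₁ and c₁ raised by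
1) and F₂ (a₂ and c₂ raised as well) are linked by three first order relations: (θ + c₁)F₁ is a
multiple of (θ + a₁)F₀, (θ + c₂)F₂ of (θ + a₂)F₁, and θF₀ of z(θ + a₃)F₂. Along z = Ψ(x), θ becomes
x m(x) d/dx with m = Ψ/(xΨ').

An analytic solution of the pulled back system is determined by Y₀(0)
(`eq_zero_of_isPulledSystemAt`): the operators preserve the order of vanishing, while the factor Ψ
in the last relation raises it, so a solution with Y₀(0) = 0 has infinite order. Each evaluation
thus reduces to completing the claimed closed form to a triple and checking three relations
(`eventuallyEq_hyp_of_isPulledSystemAt`).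

In each triple a common radical prefactor with algebraic logarithmic derivative cancels. The radical
case leaves identities of rational functions (`radical_isPulledSystemAt`) and gives three
evaluations at once. The dihedral case leaves identities in ℂ(x)(w), w² = R₁R₂
(`dih_pullOp_relations`). They hold for both signs of w: w = `sqrtR` gives the first dihedral
evaluation, and w = -`sqrtR`, with prefactor twisted by Ψ₄^(-1/2), gives its companion with local
exponent 1/2.

Part (a) is the Frobenius method on coefficients, plus explicit integer shifts. -/

/-! ### Power series on the disc and Frobenius solutions -/

/-- The sum of the power series with coefficients `c`. -/
def powSum (c : ℕ → ℂ) (z : ℂ) : ℂ := ∑' n : ℕ, c n * z ^ n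

/-- The power series with coefficients `c` converges on the open unit disc. -/
def ConvergesOnDisc (c : ℕ → ℂ) : Prop := ∀ z : ℂ, ‖z‖ < 1 → Summable fun n => c n * z ^ n

theorem isOpen_slitDisc : IsOpen slitDisc :=
  (isOpen_lt continuous_norm continuous_const).inter Complex.isOpen_slitPlane

theorem ConvergesOnDisc.local_bound {c : ℕ → ℂ} (hc : ConvergesOnDisc c) {z : ℂ} (hz : ‖z‖ < 1) :
    ∃ r : ℝ, ‖z‖ < r ∧ r < 1 ∧ Summable (fun n => ‖c n‖ * r ^ n) ∧
      ∀ (n : ℕ) (w : ℂ), w ∈ Metric.ball (0 : ℂ) r → ‖c n * w ^ n‖ ≤ ‖c n‖ * r ^ n := by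
  obtain ⟨r, hzr, hr1⟩ := exists_between hz
  have hr0 : 0 ≤ r := (norm_nonneg z).trans hzr.le
  refine ⟨r, hzr, hr1, ?_, fun n w hw => ?_⟩
  · have := (hc (r : ℂ) (by simpa [abs_of_nonneg hr0] using hr1)).norm
    simpa [abs_of_nonneg hr0] using this
  · rw [norm_mul, norm_pow]
    have hw' : ‖w‖ < r := by simpa using hw
    gcongr

theorem ConvergesOnDisc.differentiableAt {c : ℕ → ℂ} (hc : ConvergesOnDisc c) {z : ℂ}
    (hz : ‖z‖ < 1) : DifferentiableAt ℂ (powSum c) z := by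
  obtain ⟨r, hzr, -, hs, hb⟩ := hc.local_bound hz
  exact (Complex.differentiableOn_tsum_of_summable_norm hs (fun n => by fun_prop) Metric.isOpen_ball
    hb).differentiableAt (Metric.isOpen_ball.mem_nhds (by simpa using hzr))

theorem ConvergesOnDisc.differentiableOn {c : ℕ → ℂ} (hc : ConvergesOnDisc c) :
    DifferentiableOn ℂ (powSum c) (Metric.ball 0 1) := fun z hz =>
  (hc.differentiableAt (by simpa using hz)).differentiableWithinAt

theorem ConvergesOnDisc.analyticAt_zero {c : ℕ → ℂ} (hc : ConvergesOnDisc c) :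
    AnalyticAt ℂ (powSum c) 0 :=
  hc.differentiableOn.analyticAt (Metric.isOpen_ball.mem_nhds (by simp))

theorem powSum_zero (c : ℕ → ℂ) : powSum c 0 = c 0 := by
  rw [powSum, tsum_eq_single 0 (fun n hn => by simp [hn])]
  simp

theorem ConvergesOnDisc.hasSum_mul_deriv {c : ℕ → ℂ} (hc : ConvergesOnDisc c) {z : ℂ}
    (hz : ‖z‖ < 1) : HasSum (fun n : ℕ => n * c n * z ^ n) (z * deriv (powSum c) z) := by
  obtain ⟨r, hzr, -, hs, hb⟩ := hc.local_bound hz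
  have h := Complex.hasSum_deriv_of_summable_norm hs (fun n => by fun_prop) Metric.isOpen_ball
    hb (z := z) (by simpa using hzr)
  have h2 := h.mul_left z
  have e : (fun n : ℕ => n * c n * z ^ n) = fun n => z * deriv (fun w => c n * w ^ n) z := by
    funext n
    rw [((hasDerivAt_pow n z).const_mul (c n)).deriv]
    rcases n with _ | n
    · simp
    · rw [Nat.add_sub_cancel, pow_succ]
      ring
  rw [e]
  exact h2

theorem ConvergesOnDisc.mul_add {c : ℕ → ℂ} (hc : ConvergesOnDisc c) (d : ℂ) :
    ConvergesOnDisc fun n => (n + d) * c n := fun z hz => by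
  refine ((hc.hasSum_mul_deriv hz).summable.add ((hc z hz).mul_left d)).congr fun n => ?_
  ring

theorem ConvergesOnDisc.eulerOp_powSum {c : ℕ → ℂ} (hc : ConvergesOnDisc c) (d : ℂ) {z : ℂ}
    (hz : ‖z‖ < 1) : eulerOp d (powSum c) z = powSum (fun n => (n + d) * c n) z := by
  have h := (hc.hasSum_mul_deriv hz).add ((hc z hz).hasSum.mul_left d)
  rw [eulerOp, ← powSum] at *
  refine h.tsum_eq.symm.trans (tsum_congr fun n => ?_)
  ring

theorem ConvergesOnDisc.powSum_eq {c : ℕ → ℂ} (hc : ConvergesOnDisc c) {z : ℂ} (hz : ‖z‖ < 1) :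
    powSum c z = c 0 + z * powSum (fun n => c (n + 1)) z := by
  rw [powSum, (hc z hz).tsum_eq_zero_add, powSum, ← tsum_mul_left]
  simp only [pow_zero, mul_one, pow_succ]
  congr 1
  exact tsum_congr fun n => by ring

theorem eulerOp_congr {U : Set ℂ} (hU : IsOpen U) {f g : ℂ → ℂ} (h : Set.EqOn f g U) (d : ℂ) :
    Set.EqOn (eulerOp d f) (eulerOp d g) U := fun z hz => by
  have : f =ᶠ[𝓝 z] g := h.eventuallyEq_of_mem (hU.mem_nhds hz)
  rw [eulerOp, eulerOp, this.deriv_eq, h hz]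

theorem hasDerivAt_cpow_mul_powSum {c : ℕ → ℂ} (hc : ConvergesOnDisc c) (s : ℂ) {z : ℂ}
    (hz : z ∈ slitDisc) : HasDerivAt (fun z => z ^ s * powSum c z)
      (s * z ^ (s - 1) * powSum c z + z ^ s * deriv (powSum c) z) z := by
  have h1 := (hasDerivAt_id z).cpow_const (c := s) hz.2
  simp only [id_eq, mul_one] at h1
  exact h1.fun_mul (hc.differentiableAt hz.1).hasDerivAt

theorem eulerOp_cpow_mul_powSum {c : ℕ → ℂ} (hc : ConvergesOnDisc c) (s d : ℂ) :
    Set.EqOn (eulerOp d fun z => z ^ s * powSum c z)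
      (fun z => z ^ s * powSum (fun n => (n + (s + d)) * c n) z) slitDisc := fun z hz => by
  have hz0 : z ≠ 0 := Complex.slitPlane_ne_zero hz.2
  simp only [eulerOp, (hasDerivAt_cpow_mul_powSum hc s hz).deriv]
  rw [← hc.eulerOp_powSum (s + d) hz.1, eulerOp, Complex.cpow_sub _ _ hz0, Complex.cpow_one]
  field_simp
  ring

/-- Frobenius method: z d/dz + d multiplies the coefficient of z^(n+s) by n + s + d, so the equation
is the recurrence `hrec` together with the indicial equation `h0`. -/
theorem isHypSolutionOn_cpow_mul {a : Fin 3 → ℂ} {b : Fin 2 → ℂ} {s : ℂ} {c : ℕ → ℂ}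
    (hc : ConvergesOnDisc c) (h0 : s * ((s + b 0 - 1) * (s + b 1 - 1)) = 0)
    (hrec : ∀ n : ℕ, (n + 1 + s) * ((n + s + b 0) * (n + s + b 1)) * c (n + 1) =
      (n + s + a 0) * (n + s + a 1) * (n + s + a 2) * c n) :
    IsHypSolutionOn a b slitDisc fun z => z ^ s * powSum c z := by
  refine ⟨fun z hz => (hasDerivAt_cpow_mul_powSum hc s hz).differentiableAt.differentiableWithinAt,
    fun z hz => ?_⟩
  have hz0 : z ≠ 0 := Complex.slitPlane_ne_zero hz.2
  have hU := isOpen_slitDisc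
  have two (d e : ℂ) : Set.EqOn (eulerOp e (eulerOp d fun z => z ^ s * powSum c z))
      (fun z => z ^ s * powSum (fun n => (n + (s + e)) * ((n + (s + d)) * c n)) z) slitDisc :=
    (eulerOp_congr hU (eulerOp_cpow_mul_powSum hc s d) e).trans
      (eulerOp_cpow_mul_powSum (hc.mul_add _) s e)
  have hL := ((eulerOp_congr hU (two (a 2) (a 1)) (a 0)).trans
    (eulerOp_cpow_mul_powSum ((hc.mul_add _).mul_add _) s (a 0))) hz
  have hR := ((eulerOp_congr hU (two (b 1 - 1) (b 0 - 1)) 0).trans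
    (eulerOp_cpow_mul_powSum ((hc.mul_add _).mul_add _) s 0)) hz
  rw [hL]
  simp only [((hc.mul_add _).mul_add _).mul_add _ |>.powSum_eq hz.1] at hR
  -- Multiplying by z turns the outer d/dz into `eulerOp 0`, which also acts diagonally on
  -- coefficients.
  apply mul_left_cancel₀ hz0
  have hR' : z * deriv (eulerOp (b 0 - 1) (eulerOp (b 1 - 1) fun z => z ^ s * powSum c z)) z =
      eulerOp 0 (eulerOp (b 0 - 1) (eulerOp (b 1 - 1) fun z => z ^ s * powSum c z)) z := by
    simp [eulerOp]
  rw [hR', hR]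
  have e : (fun n : ℕ => ((n + 1 : ℕ) + (s + 0)) * (((n + 1 : ℕ) + (s + (b 0 - 1))) *
      (((n + 1 : ℕ) + (s + (b 1 - 1))) * c (n + 1)))) =
      fun n : ℕ => (n + (s + a 0)) * ((n + (s + a 1)) * ((n + (s + a 2)) * c n)) := by
    funext n
    push_cast
    linear_combination hrec n
  -- The lowest term has no partner on the other side; the indicial equation kills it.
  have z0 : ((0 : ℕ) + (s + 0)) * (((0 : ℕ) + (s + (b 0 - 1))) *
      (((0 : ℕ) + (s + (b 1 - 1))) * c 0)) = 0 := by
    push_cast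
    linear_combination c 0 * h0
  rw [e, z0]
  ring

/-! ### Coefficients of ₃F₂: recurrence, contiguity, convergence -/

/-- The coefficients of the power series defining `₃F₂`. -/
def hypCoeff (a : Fin 3 → ℂ) (b : Fin 2 → ℂ) (n : ℕ) : ℂ :=
  (∏ i, (ascPochhammer ℂ n).eval (a i)) /
    ((∏ j, (ascPochhammer ℂ n).eval (b j)) * (n.factorial : ℂ))

theorem hyp3F2_eq_powSum (a : Fin 3 → ℂ) (b : Fin 2 → ℂ) : hyp3F2 a b = powSum (hypCoeff a b) := rfl

theorem hypCoeff_zero (a : Fin 3 → ℂ) (b : Fin 2 → ℂ) : hypCoeff a b 0 = 1 := by simp [hypCoeff]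

/-- `c` is not a nonpositive integer. -/
def NotNonposInt (c : ℂ) : Prop := ∀ n : ℕ, (n : ℂ) + c ≠ 0

theorem NotNonposInt.eval_ne_zero {c : ℂ} (hc : NotNonposInt c) (n : ℕ) :
    (ascPochhammer ℂ n).eval c ≠ 0 := by
  induction n with
  | zero => simp
  | succ n ih =>
    rw [ascPochhammer_succ_eval, add_comm c]
    exact mul_ne_zero ih (hc n)

theorem NotNonposInt.add_one {c : ℂ} (hc : NotNonposInt c) : NotNonposInt (c + 1) := fun n => by
  have := hc (n + 1)
  push_cast at this
  rwa [add_assoc, add_comm 1 c] at this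

theorem NotNonposInt.ne_zero {c : ℂ} (hc : NotNonposInt c) : c ≠ 0 := by simpa using hc 0

theorem hypCoeff_succ (a : Fin 3 → ℂ) {b : Fin 2 → ℂ} (hb : ∀ j, NotNonposInt (b j)) (n : ℕ) :
    (n + 1) * ((n + b 0) * (n + b 1)) * hypCoeff a b (n + 1) =
      (n + a 0) * (n + a 1) * (n + a 2) * hypCoeff a b n := by
  have h0 := (hb 0).eval_ne_zero n
  have h1 := (hb 1).eval_ne_zero n
  have h0' := hb 0 n
  have h1' := hb 1 n
  have hn : (n.factorial : ℂ) ≠ 0 := by exact_mod_cast n.factorial_ne_zero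
  have hn' : (n : ℂ) + 1 ≠ 0 := by exact_mod_cast n.succ_ne_zero
  simp only [hypCoeff, Fin.prod_univ_three, Fin.prod_univ_two, ascPochhammer_succ_eval,
    Nat.factorial_succ, Nat.cast_mul, Nat.cast_succ]
  rw [add_comm (n : ℂ) (b 0)] at *
  rw [add_comm (n : ℂ) (b 1)] at *
  field_simp
  ring

theorem ascPochhammer_eval_add_one (a : ℂ) (n : ℕ) :
    a * (ascPochhammer ℂ n).eval (a + 1) = (n + a) * (ascPochhammer ℂ n).eval a := by
  have h1 := ascPochhammer_succ_eval n a
  rw [ascPochhammer_succ_left] at h1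
  simp only [Polynomial.eval_mul, Polynomial.eval_X, Polynomial.eval_comp, Polynomial.eval_add,
    Polynomial.eval_one] at h1
  rw [h1]
  ring

/-- Comes from a (a+1)ₙ = (n + a)(a)ₙ, applied to an upper and a lower parameter. -/
theorem hypCoeff_add_one {a₁ a₂ a₃ c₁ c₂ : ℂ} (hc₁ : NotNonposInt c₁) (n : ℕ) :
    a₁ * ((n + c₁) * hypCoeff ![a₁ + 1, a₂, a₃] ![c₁ + 1, c₂] n) =
      c₁ * ((n + a₁) * hypCoeff ![a₁, a₂, a₃] ![c₁, c₂] n) := by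
  have ha := ascPochhammer_eval_add_one a₁ n
  have hc := ascPochhammer_eval_add_one c₁ n
  have h0 := hc₁.eval_ne_zero n
  have h0' := hc₁.add_one.eval_ne_zero n
  have hn := hc₁ n
  simp only [hypCoeff, Fin.prod_univ_three, Fin.prod_univ_two, Matrix.cons_val_zero,
    Matrix.cons_val_one, Matrix.cons_val]
  have e : (ascPochhammer ℂ n).eval (c₁ + 1) = (n + c₁) * (ascPochhammer ℂ n).eval c₁ / c₁ := by
    rw [eq_div_iff hc₁.ne_zero, ← hc, mul_comm]
  have hc0 := hc₁.ne_zero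
  calc _ = (n + c₁) * ((a₁ * (ascPochhammer ℂ n).eval (a₁ + 1)) *
        (ascPochhammer ℂ n).eval a₂ * (ascPochhammer ℂ n).eval a₃ /
        ((ascPochhammer ℂ n).eval (c₁ + 1) * (ascPochhammer ℂ n).eval c₂ * n.factorial)) := by ring
    _ = _ := by
      rw [ha, e]
      simp only [div_eq_mul_inv, mul_inv, inv_inv]
      field_simp

theorem hypCoeff_swap_left (a₁ a₂ a₃ c₁ c₂ : ℂ) :
    hypCoeff ![a₁, a₂, a₃] ![c₁, c₂] = hypCoeff ![a₂, a₁, a₃] ![c₂, c₁] := by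
  funext n
  simp only [hypCoeff, Fin.prod_univ_three, Fin.prod_univ_two, Matrix.cons_val_zero,
    Matrix.cons_val_one, Matrix.cons_val]
  ring

theorem hypCoeff_add_one_right {a₁ a₂ a₃ c₁ c₂ : ℂ} (hc₂ : NotNonposInt c₂) (n : ℕ) :
    a₂ * ((n + c₂) * hypCoeff ![a₁, a₂ + 1, a₃] ![c₁, c₂ + 1] n) =
      c₂ * ((n + a₂) * hypCoeff ![a₁, a₂, a₃] ![c₁, c₂] n) := by
  rw [hypCoeff_swap_left a₁, hypCoeff_swap_left a₁]
  exact hypCoeff_add_one hc₂ n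

/-- Closes the cycle of contiguity relations: the recurrence supplies the step n to n + 1, and two
parameter shifts absorb the factors n + a₁ and n + a₂. -/
theorem hypCoeff_succ_eq_add_one {a₁ a₂ a₃ c₁ c₂ : ℂ} (hc₁ : NotNonposInt c₁)
    (hc₂ : NotNonposInt c₂) (n : ℕ) :
    c₁ * c₂ * ((n + 1) * hypCoeff ![a₁, a₂, a₃] ![c₁, c₂] (n + 1)) =
      a₁ * a₂ * ((n + a₃) * hypCoeff ![a₁ + 1, a₂ + 1, a₃] ![c₁ + 1, c₂ + 1] n) := by
  have h := hypCoeff_succ ![a₁, a₂, a₃] (b := ![c₁, c₂])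
    (fun j => by fin_cases j <;> simpa) n
  simp only [Matrix.cons_val_zero, Matrix.cons_val_one, Matrix.cons_val] at h
  have h1 := hypCoeff_add_one (a₁ := a₁) (a₂ := a₂) (a₃ := a₃) (c₂ := c₂) hc₁ n
  have h2 := hypCoeff_add_one_right (a₁ := a₁ + 1) (a₂ := a₂) (a₃ := a₃) (c₁ := c₁ + 1) hc₂ n
  apply mul_left_cancel₀ (mul_ne_zero (hc₁ n) (hc₂ n))
  linear_combination c₁ * c₂ * h - a₁ * (n + c₁) * (n + a₃) * h2 - c₂ * (n + a₃) * (n + a₂) * h1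

/-- Ratio test; the condition on the upper parameters keeps all coefficients nonzero, so that ratios
make sense. -/
theorem convergesOnDisc_hypCoeff {a : Fin 3 → ℂ} {b : Fin 2 → ℂ} (ha : ∀ i, NotNonposInt (a i))
    (hb : ∀ j, NotNonposInt (b j)) : ConvergesOnDisc (hypCoeff a b) := fun z hz => by
  rcases eq_or_ne z 0 with rfl | hz0
  · exact summable_of_ne_finset_zero (s := {0}) fun n hn => by
      simp [show n ≠ 0 by simpa using hn]
  have hne (n : ℕ) : hypCoeff a b n ≠ 0 := by
    refine div_ne_zero (Finset.prod_ne_zero_iff.2 fun i _ => (ha i).eval_ne_zero n)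
      (mul_ne_zero (Finset.prod_ne_zero_iff.2 fun j _ => (hb j).eval_ne_zero n) ?_)
    exact_mod_cast n.factorial_ne_zero
  refine summable_of_ratio_test_tendsto_lt_one hz
    (Eventually.of_forall fun n => mul_ne_zero (hne n) (pow_ne_zero n hz0)) ?_
  have t (p q : ℂ) : Tendsto (fun n : ℕ => ((p + 1 * n) / (q + 1 * n) : ℂ)) atTop (𝓝 1) := by
    simpa using tendsto_add_mul_div_add_mul_atTop_nhds p q (1 : ℂ) one_ne_zero
  have ht := ((((t (a 0) 1).mul (t (a 1) (b 0))).mul (t (a 2) (b 1))).mul_const z).norm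
  simp only [mul_one, one_mul] at ht
  refine ht.congr fun n => ?_
  rw [← norm_div]
  congr 1
  have h0' := hb 0 n
  have h1' := hb 1 n
  have hn' : (n : ℂ) + 1 ≠ 0 := by exact_mod_cast n.succ_ne_zero
  have hs := hypCoeff_succ a hb n
  rw [add_comm (a 0), add_comm (a 1), add_comm (a 2), add_comm (b 0), add_comm (b 1),
    add_comm (1 : ℂ), eq_div_iff (mul_ne_zero (hne n) (pow_ne_zero n hz0)), pow_succ]
  field_simp
  linear_combination -hs

/-! ### The pulled back contiguity system and its uniqueness -/

/-- The operator `x m(x) d/dx + c`, the pullback of `z d/dz + c` along a covering `z = Ψ(x)` with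
`Ψ = x m Ψ'`. -/
def pullOp (m : ℂ → ℂ) (c : ℂ) (y : ℂ → ℂ) : ℂ → ℂ :=
  fun x => x * m x * deriv y x + c * y x

theorem pullOp_congr {m : ℂ → ℂ} {f g : ℂ → ℂ} (h : f =ᶠ[𝓝 0] g) (c : ℂ) :
    pullOp m c f =ᶠ[𝓝 0] pullOp m c g := by
  filter_upwards [h, h.deriv] with x hx hx'
  rw [pullOp, pullOp, hx, hx']

theorem analyticAt_pullOp {m f : ℂ → ℂ} (hm : AnalyticAt ℂ m 0) (hf : AnalyticAt ℂ f 0) (c : ℂ) :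
    AnalyticAt ℂ (pullOp m c f) 0 :=
  ((analyticAt_id.mul hm).mul hf.deriv).add (analyticAt_const.mul hf)

/-- If f = xⁿk with k(0) ≠ 0, the image is xⁿ((n m + c)k + x m k'), whose second factor equals (n +
c)k(0) at 0. -/
theorem analyticOrderAt_pullOp {m f : ℂ → ℂ} (hm : AnalyticAt ℂ m 0) (hm0 : m 0 = 1)
    (hf : AnalyticAt ℂ f 0) {c : ℂ} (hc : ∀ n : ℕ, analyticOrderAt f 0 = n → (n : ℂ) + c ≠ 0) :
    analyticOrderAt (pullOp m c f) 0 = analyticOrderAt f 0 := by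
  by_cases ht : analyticOrderAt f 0 = ⊤
  · rw [ht, analyticOrderAt_eq_top]
    have h0 : f =ᶠ[𝓝 0] fun _ => 0 := analyticOrderAt_eq_top.1 ht
    filter_upwards [pullOp_congr (m := m) h0 c] with x hx
    rw [hx]
    simp [pullOp]
  · obtain ⟨n, hn⟩ := ENat.ne_top_iff_exists.1 ht
    rw [← hn, (analyticAt_pullOp hm hf c).analyticOrderAt_eq_natCast]
    obtain ⟨k, hk, hk0, hfk⟩ := hf.analyticOrderAt_eq_natCast.1 hn.symm
    refine ⟨fun x => (n * m x + c) * k x + x * m x * deriv k x, ?_, ?_, ?_⟩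
    · exact (((analyticAt_const.mul hm).add analyticAt_const).mul hk).add
        ((analyticAt_id.mul hm).mul hk.deriv)
    · simpa [hm0] using ⟨hc n hn.symm, hk0⟩
    · have hfk' : f =ᶠ[𝓝 0] fun x => x ^ n * k x := by
        filter_upwards [hfk] with x hx
        simpa using hx
      filter_upwards [pullOp_congr (m := m) hfk' c, hk.eventually_analyticAt] with x hx hkx
      rw [hx, pullOp, ((hasDerivAt_pow n x).fun_mul hkx.differentiableAt.hasDerivAt).deriv]
      rcases n with _ | n
      · simp
        ring
      · simp only [sub_zero, smul_eq_mul, Nat.add_sub_cancel, pow_succ]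
        ring

/-- Three functions satisfying the first order system of the contiguous functions
`₃F₂(a₁, a₂, a₃; c₁, c₂)`, `₃F₂(a₁+1, a₂, a₃; c₁+1, c₂)`, `₃F₂(a₁+1, a₂+1, a₃; c₁+1, c₂+1)`, pulled
back along `Ψ`. -/
def IsPulledSystemAt (m Ψ : ℂ → ℂ) (a₁ a₂ a₃ c₁ c₂ : ℂ) (Y₀ Y₁ Y₂ : ℂ → ℂ) (x : ℂ) : Prop :=
  c₁ * c₂ * pullOp m 0 Y₀ x = a₁ * a₂ * (Ψ x * pullOp m a₃ Y₂ x) ∧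
    a₁ * pullOp m c₁ Y₁ x = c₁ * pullOp m a₁ Y₀ x ∧ a₂ * pullOp m c₂ Y₂ x = c₂ * pullOp m a₂ Y₁ x

/-- Going once around the three relations gives ord Y₀ = ord Ψ + ord Y₀ with ord Ψ ≥ 1, which forces
ord Y₀ = ∞. -/
theorem eq_zero_of_isPulledSystemAt {m Ψ : ℂ → ℂ} (hm : AnalyticAt ℂ m 0) (hm0 : m 0 = 1)
    (hΨ : AnalyticAt ℂ Ψ 0) (hΨ0 : Ψ 0 = 0) {a₁ a₂ a₃ c₁ c₂ : ℂ}
    (ha₁ : NotNonposInt a₁) (ha₂ : NotNonposInt a₂) (ha₃ : NotNonposInt a₃)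
    (hc₁ : NotNonposInt c₁) (hc₂ : NotNonposInt c₂) {Y₀ Y₁ Y₂ : ℂ → ℂ}
    (h₀ : AnalyticAt ℂ Y₀ 0) (h₁ : AnalyticAt ℂ Y₁ 0) (h₂ : AnalyticAt ℂ Y₂ 0) (h : Y₀ 0 = 0)
    (hY : ∀ᶠ x in 𝓝 0, IsPulledSystemAt m Ψ a₁ a₂ a₃ c₁ c₂ Y₀ Y₁ Y₂ x) :
    Y₀ =ᶠ[𝓝 0] 0 ∧ Y₁ =ᶠ[𝓝 0] 0 ∧ Y₂ =ᶠ[𝓝 0] 0 := by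
  have ord {c k : ℂ} (hk : k ≠ 0) {f : ℂ → ℂ} (hf : AnalyticAt ℂ f 0)
      (hc : ∀ n : ℕ, analyticOrderAt f 0 = n → (n : ℂ) + c ≠ 0) :
      analyticOrderAt (fun x => k * pullOp m c f x) 0 = analyticOrderAt f 0 := by
    have := analyticOrderAt_mul (𝕜 := ℂ) (f := fun _ => k) (g := pullOp m c f) (z₀ := 0)
      analyticAt_const (analyticAt_pullOp hm hf c)
    rw [analyticOrderAt_pullOp hm hm0 hf hc,
      analyticAt_const.analyticOrderAt_eq_zero.2 hk, zero_add] at this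
    exact this
  have e₁ : analyticOrderAt Y₁ 0 = analyticOrderAt Y₀ 0 := by
    rw [← ord ha₁.ne_zero h₁ (fun n _ => hc₁ n), ← ord hc₁.ne_zero h₀ (fun n _ => ha₁ n)]
    exact analyticOrderAt_congr (hY.mono fun x hx => hx.2.1)
  have e₂ : analyticOrderAt Y₂ 0 = analyticOrderAt Y₁ 0 := by
    rw [← ord ha₂.ne_zero h₂ (fun n _ => hc₂ n), ← ord hc₂.ne_zero h₁ (fun n _ => ha₂ n)]
    exact analyticOrderAt_congr (hY.mono fun x hx => hx.2.2)
  have hne : analyticOrderAt Y₀ 0 ≠ 0 := h₀.analyticOrderAt_ne_zero.2 h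
  -- Here the operator has c = 0 and would lose the order of a function not vanishing at 0; this is
  -- where Y₀(0) = 0 enters.
  have e₀ : analyticOrderAt Y₀ 0 = analyticOrderAt Ψ 0 + analyticOrderAt Y₂ 0 := by
    rw [← ord (mul_ne_zero hc₁.ne_zero hc₂.ne_zero) h₀ (c := 0) (fun n hn => by
        rw [add_zero]
        rintro h
        rw [h₀.analyticOrderAt_eq_natCast] at hn
        obtain rfl : n = 0 := by exact_mod_cast h
        exact hne (h₀.analyticOrderAt_eq_natCast.2 hn)),
      ← ord (mul_ne_zero ha₁.ne_zero ha₂.ne_zero) h₂ (fun n _ => ha₃ n),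
      ← analyticOrderAt_mul hΨ (g := fun x => a₁ * a₂ * pullOp m a₃ Y₂ x)
        (analyticAt_const.mul (analyticAt_pullOp hm h₂ a₃))]
    refine analyticOrderAt_congr (hY.mono fun x hx => hx.1.trans ?_)
    simp only [Pi.mul_apply]
    ring
  have hΨ1 : analyticOrderAt Ψ 0 ≠ 0 := hΨ.analyticOrderAt_ne_zero.2 hΨ0
  have top : analyticOrderAt Y₀ 0 = ⊤ := by
    by_contra hn
    rw [e₂, e₁] at e₀
    exact hΨ1 ((ENat.add_left_injective_of_ne_top hn) (by simpa using e₀.symm))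
  exact ⟨analyticOrderAt_eq_top.1 top, analyticOrderAt_eq_top.1 (e₁.trans top),
    analyticOrderAt_eq_top.1 (e₂.trans (e₁.trans top))⟩

theorem pullOp_comp {m Ψ f : ℂ → ℂ} {x : ℂ} (hf : DifferentiableAt ℂ f (Ψ x))
    (hΨ : DifferentiableAt ℂ Ψ x) (hx : x * m x * deriv Ψ x = Ψ x) (c : ℂ) :
    pullOp m c (fun x => f (Ψ x)) x = eulerOp c f (Ψ x) := by
  have h := (hf.hasDerivAt.comp x hΨ.hasDerivAt).deriv
  rw [pullOp, eulerOp]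
  rw [Function.comp_def] at h
  rw [h]
  nth_rewrite 3 [← hx]
  ring

theorem isPulledSystemAt_hyp {m Ψ : ℂ → ℂ} {a₁ a₂ a₃ c₁ c₂ : ℂ}
    (ha₁ : NotNonposInt a₁) (ha₂ : NotNonposInt a₂) (ha₃ : NotNonposInt a₃)
    (hc₁ : NotNonposInt c₁) (hc₂ : NotNonposInt c₂) {x : ℂ} (hx1 : ‖Ψ x‖ < 1)
    (hΨ : DifferentiableAt ℂ Ψ x) (hx : x * m x * deriv Ψ x = Ψ x) :
    IsPulledSystemAt m Ψ a₁ a₂ a₃ c₁ c₂ (fun x => hyp3F2 ![a₁, a₂, a₃] ![c₁, c₂] (Ψ x))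
      (fun x => hyp3F2 ![a₁ + 1, a₂, a₃] ![c₁ + 1, c₂] (Ψ x))
      (fun x => hyp3F2 ![a₁ + 1, a₂ + 1, a₃] ![c₁ + 1, c₂ + 1] (Ψ x)) x := by
  have C₀ : ConvergesOnDisc (hypCoeff ![a₁, a₂, a₃] ![c₁, c₂]) :=
    convergesOnDisc_hypCoeff (fun i => by fin_cases i <;> simpa) (fun i => by fin_cases i <;> simpa)
  have C₁ : ConvergesOnDisc (hypCoeff ![a₁ + 1, a₂, a₃] ![c₁ + 1, c₂]) :=
    convergesOnDisc_hypCoeff (fun i => by fin_cases i <;> simp [*, ha₁.add_one])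
      (fun i => by fin_cases i <;> simp [*, hc₁.add_one])
  have C₂ : ConvergesOnDisc (hypCoeff ![a₁ + 1, a₂ + 1, a₃] ![c₁ + 1, c₂ + 1]) :=
    convergesOnDisc_hypCoeff (fun i => by fin_cases i <;> simp [*, ha₁.add_one, ha₂.add_one])
      (fun i => by fin_cases i <;> simp [*, hc₁.add_one, hc₂.add_one])
  simp only [hyp3F2_eq_powSum]
  refine ⟨?_, ?_, ?_⟩
  · rw [pullOp_comp (C₀.differentiableAt hx1) hΨ hx, pullOp_comp (C₂.differentiableAt hx1) hΨ hx,
      C₀.eulerOp_powSum _ hx1, C₂.eulerOp_powSum _ hx1, (C₀.mul_add 0).powSum_eq hx1]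
    simp only [Nat.cast_zero, add_zero, zero_mul, zero_add, powSum, ← tsum_mul_left]
    refine tsum_congr fun n => ?_
    push_cast
    linear_combination (Ψ x * Ψ x ^ n) * hypCoeff_succ_eq_add_one hc₁ hc₂ n
      (a₁ := a₁) (a₂ := a₂) (a₃ := a₃)
  · rw [pullOp_comp (C₀.differentiableAt hx1) hΨ hx, pullOp_comp (C₁.differentiableAt hx1) hΨ hx,
      C₀.eulerOp_powSum _ hx1, C₁.eulerOp_powSum _ hx1]
    simp only [powSum, ← tsum_mul_left]
    refine tsum_congr fun n => ?_
    linear_combination Ψ x ^ n * hypCoeff_add_one hc₁ n (a₁ := a₁) (a₂ := a₂) (a₃ := a₃) (c₂ := c₂)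
  · rw [pullOp_comp (C₁.differentiableAt hx1) hΨ hx, pullOp_comp (C₂.differentiableAt hx1) hΨ hx,
      C₁.eulerOp_powSum _ hx1, C₂.eulerOp_powSum _ hx1]
    simp only [powSum, ← tsum_mul_left]
    refine tsum_congr fun n => ?_
    linear_combination Ψ x ^ n * hypCoeff_add_one_right hc₂ n
      (a₁ := a₁ + 1) (a₂ := a₂) (a₃ := a₃) (c₁ := c₁ + 1)

/-- Analytic solutions of the pulled back contiguity system are determined by one initial value. -/
theorem eventuallyEq_hyp_of_isPulledSystemAt {m Ψ : ℂ → ℂ} (hm : AnalyticAt ℂ m 0) (hm0 : m 0 = 1)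
    (hΨ : AnalyticAt ℂ Ψ 0) (hΨ0 : Ψ 0 = 0) (hmΨ : ∀ᶠ x in 𝓝 0, x * m x * deriv Ψ x = Ψ x)
    {a₁ a₂ a₃ c₁ c₂ : ℂ}
    (ha₁ : NotNonposInt a₁) (ha₂ : NotNonposInt a₂) (ha₃ : NotNonposInt a₃)
    (hc₁ : NotNonposInt c₁) (hc₂ : NotNonposInt c₂) {Y₀ Y₁ Y₂ : ℂ → ℂ}
    (h₀ : AnalyticAt ℂ Y₀ 0) (h₁ : AnalyticAt ℂ Y₁ 0) (h₂ : AnalyticAt ℂ Y₂ 0)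
    (hY : ∀ᶠ x in 𝓝[≠] 0, IsPulledSystemAt m Ψ a₁ a₂ a₃ c₁ c₂ Y₀ Y₁ Y₂ x) :
    ∀ᶠ x in 𝓝 0, Y₀ x = Y₀ 0 * hyp3F2 ![a₁, a₂, a₃] ![c₁, c₂] (Ψ x) ∧
      Y₁ x = Y₀ 0 * hyp3F2 ![a₁ + 1, a₂, a₃] ![c₁ + 1, c₂] (Ψ x) ∧
      Y₂ x = Y₀ 0 * hyp3F2 ![a₁ + 1, a₂ + 1, a₃] ![c₁ + 1, c₂ + 1] (Ψ x) := by
  -- Both sides of each relation are analytic, so by the identity theorem the punctured neighborhood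
  -- suffices.
  have hY' : ∀ᶠ x in 𝓝 0, IsPulledSystemAt m Ψ a₁ a₂ a₃ c₁ c₂ Y₀ Y₁ Y₂ x := by
    have key {f g : ℂ → ℂ} (hf : AnalyticAt ℂ f 0) (hg : AnalyticAt ℂ g 0)
        (h : ∀ᶠ x in 𝓝[≠] 0, f x = g x) : ∀ᶠ x in 𝓝 0, f x = g x :=
      (hf.frequently_eq_iff_eventually_eq hg).1 h.frequently
    have op {f : ℂ → ℂ} (hf : AnalyticAt ℂ f 0) (c : ℂ) := analyticAt_pullOp hm hf c
    exact (key (analyticAt_const.mul (op h₀ _)) (analyticAt_const.mul (hΨ.mul (op h₂ _)))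
      (hY.mono fun x hx => hx.1)).and
      ((key (analyticAt_const.mul (op h₁ _)) (analyticAt_const.mul (op h₀ _))
      (hY.mono fun x hx => hx.2.1)).and (key (analyticAt_const.mul (op h₂ _))
      (analyticAt_const.mul (op h₁ _)) (hY.mono fun x hx => hx.2.2)))
  have an {a : Fin 3 → ℂ} {b : Fin 2 → ℂ} (ha : ∀ i, NotNonposInt (a i))
      (hb : ∀ j, NotNonposInt (b j)) : AnalyticAt ℂ (fun x => hyp3F2 a b (Ψ x)) 0 := by
    refine AnalyticAt.fun_comp (g := hyp3F2 a b) ?_ hΨ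
    rw [hΨ0, hyp3F2_eq_powSum]
    exact (convergesOnDisc_hypCoeff ha hb).analyticAt_zero
  have A₀ : AnalyticAt ℂ (fun x => hyp3F2 ![a₁, a₂, a₃] ![c₁, c₂] (Ψ x)) 0 :=
    an (fun i => by fin_cases i <;> simpa) (fun i => by fin_cases i <;> simpa)
  have A₁ : AnalyticAt ℂ (fun x => hyp3F2 ![a₁ + 1, a₂, a₃] ![c₁ + 1, c₂] (Ψ x)) 0 :=
    an (fun i => by fin_cases i <;> simp [*, ha₁.add_one])
      (fun i => by fin_cases i <;> simp [*, hc₁.add_one])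
  have A₂ : AnalyticAt ℂ (fun x => hyp3F2 ![a₁ + 1, a₂ + 1, a₃] ![c₁ + 1, c₂ + 1] (Ψ x)) 0 :=
    an (fun i => by fin_cases i <;> simp [*, ha₁.add_one, ha₂.add_one])
      (fun i => by fin_cases i <;> simp [*, hc₁.add_one, hc₂.add_one])
  have hΨ1 : ∀ᶠ x in 𝓝 0, ‖Ψ x‖ < 1 :=
    hΨ.continuousAt.norm.eventually_lt continuousAt_const (by simp [hΨ0])
  have lin {f g : ℂ → ℂ} {x : ℂ} (hf : AnalyticAt ℂ f x) (hg : AnalyticAt ℂ g x) (c : ℂ) :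
      pullOp m c (fun x => f x - Y₀ 0 * g x) x = pullOp m c f x - Y₀ 0 * pullOp m c g x := by
    simp only [pullOp]
    rw [(hf.differentiableAt.hasDerivAt.fun_sub
      (hg.differentiableAt.hasDerivAt.const_mul (Y₀ 0))).deriv]
    ring
  -- The system is linear: subtract Y₀(0) times the hypergeometric triple, whose first member is 1
  -- at the origin.
  have res := eq_zero_of_isPulledSystemAt hm hm0 hΨ hΨ0 ha₁ ha₂ ha₃ hc₁ hc₂
    (h₀.sub (analyticAt_const (v := Y₀ 0) |>.mul A₀)) (h₁.sub (analyticAt_const (v := Y₀ 0) |>.mul A₁))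
    (h₂.sub (analyticAt_const (v := Y₀ 0) |>.mul A₂))
    (by simp [hΨ0, hyp3F2_eq_powSum, powSum_zero, hypCoeff_zero]) (by
      filter_upwards [hY', hmΨ, hΨ1, hΨ.eventually_analyticAt, h₀.eventually_analyticAt,
        h₁.eventually_analyticAt, h₂.eventually_analyticAt, A₀.eventually_analyticAt,
        A₁.eventually_analyticAt, A₂.eventually_analyticAt]
        with x hx hmx hx1 hΨx y₀ y₁ y₂ f₀ f₁ f₂
      obtain ⟨p₀, p₁, p₂⟩ := isPulledSystemAt_hyp ha₁ ha₂ ha₃ hc₁ hc₂ hx1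
        hΨx.differentiableAt hmx
      obtain ⟨q₀, q₁, q₂⟩ := hx
      refine ⟨?_, ?_, ?_⟩
      · simp only [Pi.sub_def, Pi.mul_def]
        rw [lin y₀ f₀, lin y₂ f₂]
        linear_combination q₀ - Y₀ 0 * p₀
      · simp only [Pi.sub_def, Pi.mul_def]
        rw [lin y₀ f₀, lin y₁ f₁]
        linear_combination q₁ - Y₀ 0 * p₁
      · simp only [Pi.sub_def, Pi.mul_def]
        rw [lin y₁ f₁, lin y₂ f₂]
        linear_combination q₂ - Y₀ 0 * p₂)
  filter_upwards [res.1, res.2.1, res.2.2] with x e₀ e₁ e₂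
  exact ⟨sub_eq_zero.1 e₀, sub_eq_zero.1 e₁, sub_eq_zero.1 e₂⟩

/-! ### The covering `Psi₄` and its logarithmic derivative -/

theorem hasDerivAt_quartic {f : ℂ → ℂ} (c₀ c₁ c₂ c₃ c₄ : ℂ)
    (hf : ∀ x, f x = c₀ + c₁ * x + c₂ * x ^ 2 + c₃ * x ^ 3 + c₄ * x ^ 4) (x : ℂ) :
    HasDerivAt f (c₁ + 2 * c₂ * x + 3 * c₃ * x ^ 2 + 4 * c₄ * x ^ 3) x := by
  obtain rfl : f = fun x => c₀ + c₁ * x + c₂ * x ^ 2 + c₃ * x ^ 3 + c₄ * x ^ 4 := funext hf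
  have h := ((((hasDerivAt_const x c₀).fun_add ((hasDerivAt_id' x).const_mul c₁)).fun_add
    ((hasDerivAt_pow 2 x).const_mul c₂)).fun_add ((hasDerivAt_pow 3 x).const_mul c₃)).fun_add
    ((hasDerivAt_pow 4 x).const_mul c₄)
  refine h.congr_deriv ?_
  push_cast
  ring

/-- The polynomial cutting out the double points of `Ψ₄` above `1`. -/
def ramPoly (x : ℂ) : ℂ :=
  1 + 19 / 8 * x - 63 / 16 * x ^ 2 + 39 / 16 * x ^ 3 - 193 / 224 * x ^ 4 + 173 / 896 * x ^ 5 -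
    7 / 256 * x ^ 6 + 1 / 448 * x ^ 7 - 1 / 12544 * x ^ 8

/-- `Ψ₄ / (x Ψ₄')`. -/
def coverMult (x : ℂ) : ℂ := R₁ x * Q₄ x * P₄ x / ramPoly x

theorem hasDerivAt_P₄ (x : ℂ) : HasDerivAt P₄ (-1 + 1 / 2 * x - 3 / 56 * x ^ 2) x :=
  (hasDerivAt_quartic 1 (-1) (1 / 4) (-1 / 56) 0 (fun x => by rw [P₄]; ring) x).congr_deriv
    (by ring)

theorem hasDerivAt_Q₄ (x : ℂ) :
    HasDerivAt Q₄ (-1 / 2 + 1 / 14 * x + 3 / 56 * x ^ 2 - 1 / 98 * x ^ 3) x :=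
  (hasDerivAt_quartic 1 (-1 / 2) (1 / 28) (1 / 56) (-1 / 392)
    (fun x => by rw [Q₄]; ring) x).congr_deriv (by ring)

theorem hasDerivAt_R₁ (x : ℂ) : HasDerivAt R₁ (-3 / 8 + 1 / 14 * x) x :=
  (hasDerivAt_quartic 1 (-3 / 8) (1 / 28) 0 0 (fun x => by rw [R₁]; ring) x).congr_deriv
    (by ring)

theorem hasDerivAt_R₂ (x : ℂ) :
    HasDerivAt R₂ (-33 / 32 + 13 / 16 * x - 27 / 128 * x ^ 2 + 1 / 56 * x ^ 3) x :=
  (hasDerivAt_quartic 1 (-33 / 32) (13 / 32) (-9 / 128) (1 / 224)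
    (fun x => by rw [R₂]; ring) x).congr_deriv (by ring)

theorem differentiable_ramPoly : Differentiable ℂ ramPoly := by
  unfold ramPoly
  fun_prop

theorem analyticAt_P₄ (x : ℂ) : AnalyticAt ℂ P₄ x :=
  Differentiable.analyticAt (fun x => (hasDerivAt_P₄ x).differentiableAt) x

theorem analyticAt_Q₄ (x : ℂ) : AnalyticAt ℂ Q₄ x :=
  Differentiable.analyticAt (fun x => (hasDerivAt_Q₄ x).differentiableAt) x

theorem analyticAt_R₁ (x : ℂ) : AnalyticAt ℂ R₁ x :=
  Differentiable.analyticAt (fun x => (hasDerivAt_R₁ x).differentiableAt) x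

theorem analyticAt_R₂ (x : ℂ) : AnalyticAt ℂ R₂ x :=
  Differentiable.analyticAt (fun x => (hasDerivAt_R₂ x).differentiableAt) x

theorem P₄_zero : P₄ 0 = 1 := by simp [P₄]
theorem Q₄_zero : Q₄ 0 = 1 := by simp [Q₄]
theorem R₁_zero : R₁ 0 = 1 := by simp [R₁]
theorem R₂_zero : R₂ 0 = 1 := by simp [R₂]
theorem ramPoly_zero : ramPoly 0 = 1 := by simp [ramPoly]

theorem coverMult_zero : coverMult 0 = 1 := by
  simp [coverMult, P₄_zero, Q₄_zero, R₁_zero, ramPoly_zero]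

theorem analyticAt_coverMult : AnalyticAt ℂ coverMult 0 :=
  (((analyticAt_R₁ 0).mul (analyticAt_Q₄ 0)).mul (analyticAt_P₄ 0)).div
    (differentiable_ramPoly.analyticAt 0) (by simp [ramPoly_zero])

/-- Normalizing every factor to be 1 at x = 0 leaves the constant 56²·28⁴·14⁴/(4·(-56)⁷) = -343/32.
-/
theorem Psi₄_eq (x : ℂ) : Psi₄ x = -343 / 32 * (x * R₁ x ^ 2 * Q₄ x ^ 4 / P₄ x ^ 7) := by
  have e₁ : 2 * x ^ 2 - 21 * x + 56 = 56 * R₁ x := by rw [R₁]; ring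
  have e₂ : (x ^ 2 - 28) ^ 4 * (x ^ 2 - 7 * x + 14) ^ 4 = 28 ^ 4 * 14 ^ 4 * Q₄ x ^ 4 := by
    rw [Q₄]; ring
  have e₃ : x ^ 3 - 14 * x ^ 2 + 56 * x - 56 = -56 * P₄ x := by rw [P₄]; ring
  rw [Psi₄, mul_assoc (x * _), e₁, e₂, e₃]
  simp only [mul_pow, div_eq_mul_inv, mul_inv]
  ring

theorem Psi₄_zero : Psi₄ 0 = 0 := by simp [Psi₄]

theorem hasDerivAt_Psi₄ {x : ℂ} (hP : P₄ x ≠ 0) :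
    HasDerivAt Psi₄ (-343 / 32 * (R₁ x * Q₄ x ^ 3 * ramPoly x / P₄ x ^ 8)) x := by
  have h := (((((hasDerivAt_id' x).fun_mul ((hasDerivAt_R₁ x).fun_pow 2)).fun_mul
    ((hasDerivAt_Q₄ x).fun_pow 4)).fun_div ((hasDerivAt_P₄ x).fun_pow 7)
    (pow_ne_zero 7 hP)).const_mul (-343 / 32))
  rw [show Psi₄ = fun x => -343 / 32 * (x * R₁ x ^ 2 * Q₄ x ^ 4 / P₄ x ^ 7) from funext Psi₄_eq]
  refine h.congr_deriv ?_
  -- That is, `ramPoly` = R₁Q₄P₄ · xΨ₄'/Ψ₄, where xΨ₄'/Ψ₄ = 1 + x(2R₁'/R₁ + 4Q₄'/Q₄ - 7P₄'/P₄).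
  have e : ramPoly x = R₁ x * Q₄ x * P₄ x + x * (2 * (-3 / 8 + 1 / 14 * x) * Q₄ x * P₄ x +
      4 * (-1 / 2 + 1 / 14 * x + 3 / 56 * x ^ 2 - 1 / 98 * x ^ 3) * R₁ x * P₄ x -
      7 * (-1 + 1 / 2 * x - 3 / 56 * x ^ 2) * R₁ x * Q₄ x) := by
    rw [ramPoly, R₁, Q₄, P₄]
    ring
  rw [e]
  field_simp
  push_cast
  ring

theorem analyticAt_Psi₄ : AnalyticAt ℂ Psi₄ 0 := by
  rw [show Psi₄ = fun x => -343 / 32 * (x * R₁ x ^ 2 * Q₄ x ^ 4 / P₄ x ^ 7) from funext Psi₄_eq]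
  exact analyticAt_const.mul (((analyticAt_id.mul ((analyticAt_R₁ 0).pow 2)).mul
    ((analyticAt_Q₄ 0).pow 4)).div ((analyticAt_P₄ 0).pow 7) (by simp [P₄_zero]))

theorem coverMult_mul_deriv_Psi₄ {x : ℂ} (hP : P₄ x ≠ 0) (hH : ramPoly x ≠ 0) :
    x * coverMult x * deriv Psi₄ x = Psi₄ x := by
  rw [(hasDerivAt_Psi₄ hP).deriv, coverMult, Psi₄_eq]
  field_simp

theorem eventually_ne_zero {f : ℂ → ℂ} (hf : AnalyticAt ℂ f 0) (h : f 0 ≠ 0) :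
    ∀ᶠ x in 𝓝 0, f x ≠ 0 := hf.continuousAt.eventually_ne h

theorem eventually_P₄_ne_zero : ∀ᶠ x in 𝓝 0, P₄ x ≠ 0 :=
  eventually_ne_zero (analyticAt_P₄ 0) (by simp [P₄_zero])

theorem eventually_Q₄_ne_zero : ∀ᶠ x in 𝓝 0, Q₄ x ≠ 0 :=
  eventually_ne_zero (analyticAt_Q₄ 0) (by simp [Q₄_zero])

theorem eventually_R₁_ne_zero : ∀ᶠ x in 𝓝 0, R₁ x ≠ 0 :=
  eventually_ne_zero (analyticAt_R₁ 0) (by simp [R₁_zero])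

theorem eventually_R₂_ne_zero : ∀ᶠ x in 𝓝 0, R₂ x ≠ 0 :=
  eventually_ne_zero (analyticAt_R₂ 0) (by simp [R₂_zero])

theorem eventually_ramPoly_ne_zero : ∀ᶠ x in 𝓝 0, ramPoly x ≠ 0 :=
  eventually_ne_zero (differentiable_ramPoly.analyticAt 0) (by simp [ramPoly_zero])

/-! ### Principal powers and radical prefactors -/

theorem eventually_mem_slitPlane {f : ℂ → ℂ} (hf : AnalyticAt ℂ f 0) (h : f 0 = 1) :
    ∀ᶠ x in 𝓝 0, f x ∈ Complex.slitPlane :=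
  hf.continuousAt.eventually_mem (Complex.isOpen_slitPlane.mem_nhds (by simp [h]))

theorem analyticAt_cpow_const {f : ℂ → ℂ} (hf : AnalyticAt ℂ f 0) (h : f 0 = 1) (c : ℂ) :
    AnalyticAt ℂ (fun x => f x ^ c) 0 :=
  hf.cpow analyticAt_const (by simp [h])

theorem hasDerivAt_cpow_const {f : ℂ → ℂ} {x f' : ℂ} (hf : HasDerivAt f f' x)
    (h : f x ∈ Complex.slitPlane) (c : ℂ) :
    HasDerivAt (fun x => f x ^ c) (f x ^ c * (c * (f' / f x))) x := by
  refine (hf.cpow_const h).congr_deriv ?_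
  rw [Complex.cpow_sub _ _ (Complex.slitPlane_ne_zero h), Complex.cpow_one]
  ring

/-- A prefactor f with logarithmic derivative l factors out of the operator, so it cancels from
homogeneous relations. -/
theorem pullOp_mul {m f g : ℂ → ℂ} {x l g' : ℂ} (hf : HasDerivAt f (f x * l) x)
    (hg : HasDerivAt g g' x) (c : ℂ) :
    pullOp m c (fun x => f x * g x) x = f x * (x * m x * (g' + l * g x) + c * g x) := by
  rw [pullOp, (hf.fun_mul hg).deriv]
  ring

theorem hyp_Psi₄_of_isPulledSystemAt {a₁ a₂ a₃ c₁ c₂ : ℂ}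
    (ha₁ : NotNonposInt a₁) (ha₂ : NotNonposInt a₂) (ha₃ : NotNonposInt a₃)
    (hc₁ : NotNonposInt c₁) (hc₂ : NotNonposInt c₂) {Y₀ Y₁ Y₂ : ℂ → ℂ}
    (h₀ : AnalyticAt ℂ Y₀ 0) (h₁ : AnalyticAt ℂ Y₁ 0) (h₂ : AnalyticAt ℂ Y₂ 0)
    (hY : ∀ᶠ x in 𝓝[≠] 0, IsPulledSystemAt coverMult Psi₄ a₁ a₂ a₃ c₁ c₂ Y₀ Y₁ Y₂ x) :
    ∀ᶠ x in 𝓝 0, Y₀ x = Y₀ 0 * hyp3F2 ![a₁, a₂, a₃] ![c₁, c₂] (Psi₄ x) ∧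
      Y₁ x = Y₀ 0 * hyp3F2 ![a₁ + 1, a₂, a₃] ![c₁ + 1, c₂] (Psi₄ x) ∧
      Y₂ x = Y₀ 0 * hyp3F2 ![a₁ + 1, a₂ + 1, a₃] ![c₁ + 1, c₂ + 1] (Psi₄ x) := by
  refine eventuallyEq_hyp_of_isPulledSystemAt analyticAt_coverMult coverMult_zero analyticAt_Psi₄
    Psi₄_zero ?_ ha₁ ha₂ ha₃ hc₁ hc₂ h₀ h₁ h₂ hY
  filter_upwards [eventually_P₄_ne_zero, eventually_ramPoly_ne_zero] with x hP hH
  exact coverMult_mul_deriv_Psi₄ hP hH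

theorem hasDerivAt_cpow_mul_cpow {f g : ℂ → ℂ} {x f' g' : ℂ} (hf : HasDerivAt f f' x)
    (hg : HasDerivAt g g' x) (hfs : f x ∈ Complex.slitPlane) (hgs : g x ∈ Complex.slitPlane)
    (c d : ℂ) : HasDerivAt (fun x => f x ^ c * g x ^ d)
      (f x ^ c * g x ^ d * (c * (f' / f x) + d * (g' / g x))) x :=
  ((hasDerivAt_cpow_const hf hfs c).fun_mul (hasDerivAt_cpow_const hg hgs d)).congr_deriv (by ring)

/-! ### The radical triple -/

theorem radical_isPulledSystemAt {x : ℂ} (hP : P₄ x ∈ Complex.slitPlane)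
    (hR : R₁ x ∈ Complex.slitPlane) (hQ : Q₄ x ≠ 0) (hH : ramPoly x ≠ 0) :
    IsPulledSystemAt coverMult Psi₄ (-3 / 14) (1 / 14) (9 / 14) (1 / 4) (3 / 4)
      (fun x => R₁ x ^ (1 / 2 : ℂ) * P₄ x ^ (-1 / 2 : ℂ) *
        ((1 - 3 / 4 * x + 1 / 4 * x ^ 2 - 3 / 112 * x ^ 3) / P₄ x))
      (fun x => R₁ x ^ (1 / 2 : ℂ) * P₄ x ^ (-1 / 2 : ℂ) *
        (P₄ x * (1 - 3 / 5 * x + 1 / 8 * x ^ 2 - 1 / 112 * x ^ 3) / (Q₄ x * R₁ x)))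
      (fun x => R₁ x ^ (1 / 2 : ℂ) * P₄ x ^ (-1 / 2 : ℂ) *
        (P₄ x ^ 5 * (1 - 3 / 14 * x) / (Q₄ x ^ 3 * R₁ x ^ 2))) x := by
  have hP0 := Complex.slitPlane_ne_zero hP
  have hR0 := Complex.slitPlane_ne_zero hR
  have hrad := hasDerivAt_cpow_mul_cpow (hasDerivAt_R₁ x) (hasDerivAt_P₄ x) hR hP (1 / 2) (-1 / 2)
  have dP := hasDerivAt_P₄ x
  have dQ := hasDerivAt_Q₄ x
  have dR := hasDerivAt_R₁ x
  have d₀ := (hasDerivAt_quartic (f := fun x => 1 - 3 / 4 * x + 1 / 4 * x ^ 2 - 3 / 112 * x ^ 3)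
    1 (-3 / 4) (1 / 4) (-3 / 112) 0 (fun x => by ring) x).fun_div dP hP0
  have d₁ := (dP.fun_mul (hasDerivAt_quartic
    (f := fun x => 1 - 3 / 5 * x + 1 / 8 * x ^ 2 - 1 / 112 * x ^ 3)
    1 (-3 / 5) (1 / 8) (-1 / 112) 0 (fun x => by ring) x)).fun_div (dQ.fun_mul dR)
    (mul_ne_zero hQ hR0)
  have d₂ := ((dP.fun_pow 5).fun_mul (hasDerivAt_quartic (f := fun x => 1 - 3 / 14 * x)
    1 (-3 / 14) 0 0 0 (fun x => by ring) x)).fun_div ((dQ.fun_pow 3).fun_mul (dR.fun_pow 2))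
    (mul_ne_zero (pow_ne_zero 3 hQ) (pow_ne_zero 2 hR0))
  simp only [IsPulledSystemAt, pullOp_mul hrad d₀, pullOp_mul hrad d₁, pullOp_mul hrad d₂]
  -- From here the common radical is an opaque scalar to be cancelled; what remains are rational
  -- identities in x.
  generalize R₁ x ^ (1 / 2 : ℂ) * P₄ x ^ (-1 / 2 : ℂ) = ρ
  rw [coverMult, Psi₄_eq]
  push_cast
  refine ⟨?_, ?_, ?_⟩
  · rw [mul_left_comm _ ρ, mul_left_comm (-343 / 32 * _ : ℂ) ρ, mul_left_comm _ ρ]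
    congr 1
    field_simp
    simp only [R₁, P₄, Q₄, ramPoly]
    ring
  · rw [mul_left_comm _ ρ, mul_left_comm _ ρ]
    congr 1
    field_simp
    simp only [R₁, P₄, Q₄, ramPoly]
    ring
  · rw [mul_left_comm _ ρ, mul_left_comm _ ρ]
    congr 1
    field_simp
    simp only [R₁, P₄, Q₄, ramPoly]
    ring

/-! ### The dihedral triple over the double cover w² = R₁R₂ -/

def dihP (x : ℂ) : ℂ := 1 / 2 - 15 / 32 * x + 53 / 448 * x ^ 2 - 1 / 112 * x ^ 3

def dihQ (x : ℂ) : ℂ := 1 / 2 - 45 / 128 * x + 5 / 64 * x ^ 2 - 5 / 896 * x ^ 3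

/-- The rational factors of the three contiguous dihedral functions; `w` stands for a square root
of `R₁ R₂`. -/
def dihFactor₀ (x w : ℂ) : ℂ := dihP x + 1 / 2 * w

def dihFactor₁ (x w : ℂ) : ℂ :=
  P₄ x * ((1 / 2 - 11 / 48 * x + 17 / 1344 * x ^ 3 - 1 / 672 * x ^ 4) * R₁ x +
    (1 / 2 - 5 / 24 * x + 1 / 48 * x ^ 2) * w) / (Q₄ x * R₁ x)

def dihFactor₂ (x w : ℂ) : ℂ :=
  P₄ x ^ 3 * (1 - 3 / 5 * x + 1 / 8 * x ^ 2 - 1 / 112 * x ^ 3 - 2 / 5 * x * w) /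
    (R₁ x * Q₄ x ^ 2)

/-- The logarithmic derivative of `√(R₁ R₂)`. -/
def sqrtLogDeriv (x : ℂ) : ℂ :=
  1 / 2 * ((-3 / 8 + 1 / 14 * x) / R₁ x +
    (-33 / 32 + 13 / 16 * x - 27 / 128 * x ^ 2 + 1 / 56 * x ^ 3) / R₂ x)

/-- The logarithmic derivative of `P₄^(-3/4) (w / 2 + dihQ)^(-1/4)`. -/
def dihLogDeriv (x w : ℂ) : ℂ :=
  -3 / 4 * ((-1 + 1 / 2 * x - 3 / 56 * x ^ 2) / P₄ x) -
    (3 / 4 * x - 5 / 4 + (5 / 4 - 3 / 4 * x + 5 / 32 * x ^ 2 - 5 / 448 * x ^ 3) *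
      w / (R₁ x * R₂ x)) / (x * (x - 5))

theorem hasDerivAt_dihP (x : ℂ) :
    HasDerivAt dihP (-15 / 32 + 53 / 224 * x - 3 / 112 * x ^ 2) x :=
  (hasDerivAt_quartic (1 / 2) (-15 / 32) (53 / 448) (-1 / 112) 0
    (fun x => by rw [dihP]; ring) x).congr_deriv (by ring)

theorem hasDerivAt_dihQ (x : ℂ) :
    HasDerivAt dihQ (-45 / 128 + 5 / 32 * x - 15 / 896 * x ^ 2) x :=
  (hasDerivAt_quartic (1 / 2) (-45 / 128) (5 / 64) (-5 / 896) 0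
    (fun x => by rw [dihQ]; ring) x).congr_deriv (by ring)

/-- The norm of w/2 + `dihQ` is `dihQ`² - R₁R₂/4 = -x²(x - 5)⁴/114688, which explains the
denominator x(x - 5). Only w² = R₁R₂ is used, so either root is allowed. -/
theorem dihQ_logDeriv {x w : ℂ} (hw : w ^ 2 = R₁ x * R₂ x) (hR₁ : R₁ x ≠ 0) (hR₂ : R₂ x ≠ 0)
    (hk : 1 / 2 * w + dihQ x ≠ 0) (hx : x ≠ 0) (hx5 : x - 5 ≠ 0) :
    (1 / 2 * (w * sqrtLogDeriv x) + (-45 / 128 + 5 / 32 * x - 15 / 896 * x ^ 2)) /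
      (1 / 2 * w + dihQ x) =
    4 * ((3 / 4 * x - 5 / 4 + (5 / 4 - 3 / 4 * x + 5 / 32 * x ^ 2 - 5 / 448 * x ^ 3) *
      w / (R₁ x * R₂ x)) / (x * (x - 5))) := by
  rw [div_eq_iff hk, sqrtLogDeriv]
  -- The multiplier of `hw` is the coefficient of w²; what is left is linear in w and rational in x.
  linear_combination (norm := skip) (-4 * (5 / 4 - 3 / 4 * x + 5 / 32 * x ^ 2 - 5 / 448 * x ^ 3) *
    (1 / 2) / (R₁ x * R₂ x) / (x * (x - 5))) * hw
  field_simp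
  simp only [R₁, R₂, dihQ]
  ring

theorem hasDerivAt_dihFactor₀ {w : ℂ → ℂ} {x : ℂ}
    (dw : HasDerivAt w (w x * sqrtLogDeriv x) x) : HasDerivAt (fun x => dihFactor₀ x (w x))
      (-15 / 32 + 53 / 224 * x - 3 / 112 * x ^ 2 + 1 / 2 * (w x * sqrtLogDeriv x)) x :=
  (hasDerivAt_dihP x).fun_add (dw.const_mul (1 / 2))

theorem hasDerivAt_dihFactor₁ {w : ℂ → ℂ} {x : ℂ} (hQ : Q₄ x ≠ 0) (hR₁ : R₁ x ≠ 0)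
    (hP : P₄ x ≠ 0)
    (dw : HasDerivAt w (w x * sqrtLogDeriv x) x) : HasDerivAt (fun x => dihFactor₁ x (w x))
      (P₄ x / (Q₄ x * R₁ x) * ((-11 / 48 + 17 / 448 * x ^ 2 - 1 / 168 * x ^ 3) * R₁ x +
          (1 / 2 - 11 / 48 * x + 17 / 1344 * x ^ 3 - 1 / 672 * x ^ 4) * (-3 / 8 + 1 / 14 * x) +
          ((-5 / 24 + 1 / 24 * x) +
            (1 / 2 - 5 / 24 * x + 1 / 48 * x ^ 2) * sqrtLogDeriv x) * w x) +
        dihFactor₁ x (w x) * ((-1 + 1 / 2 * x - 3 / 56 * x ^ 2) / P₄ x -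
          (-1 / 2 + 1 / 14 * x + 3 / 56 * x ^ 2 - 1 / 98 * x ^ 3) / Q₄ x -
          (-3 / 8 + 1 / 14 * x) / R₁ x)) x := by
  have h₁ := (hasDerivAt_quartic (f := fun x => 1 / 2 - 11 / 48 * x + 17 / 1344 * x ^ 3 -
    1 / 672 * x ^ 4) (1 / 2) (-11 / 48) 0 (17 / 1344) (-1 / 672) (fun x => by ring) x).fun_mul
    (hasDerivAt_R₁ x)
  have h₂ := (hasDerivAt_quartic (f := fun x => 1 / 2 - 5 / 24 * x + 1 / 48 * x ^ 2)
    (1 / 2) (-5 / 24) (1 / 48) 0 0 (fun x => by ring) x).fun_mul dw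
  have h := ((hasDerivAt_P₄ x).fun_mul (h₁.fun_add h₂)).fun_div
    ((hasDerivAt_Q₄ x).fun_mul (hasDerivAt_R₁ x)) (mul_ne_zero hQ hR₁)
  refine h.congr_deriv ?_
  rw [dihFactor₁]
  field_simp
  ring

theorem hasDerivAt_dihFactor₂ {w : ℂ → ℂ} {x : ℂ} (hQ : Q₄ x ≠ 0) (hR₁ : R₁ x ≠ 0)
    (hP : P₄ x ≠ 0)
    (dw : HasDerivAt w (w x * sqrtLogDeriv x) x) : HasDerivAt (fun x => dihFactor₂ x (w x))
      (P₄ x ^ 3 / (R₁ x * Q₄ x ^ 2) * (-3 / 5 + 1 / 4 * x - 3 / 112 * x ^ 2 -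
          (2 / 5 + 2 / 5 * x * sqrtLogDeriv x) * w x) +
        dihFactor₂ x (w x) * (3 * ((-1 + 1 / 2 * x - 3 / 56 * x ^ 2) / P₄ x) -
          2 * ((-1 / 2 + 1 / 14 * x + 3 / 56 * x ^ 2 - 1 / 98 * x ^ 3) / Q₄ x) -
          (-3 / 8 + 1 / 14 * x) / R₁ x)) x := by
  have h₁ := hasDerivAt_quartic (f := fun x => 1 - 3 / 5 * x + 1 / 8 * x ^ 2 - 1 / 112 * x ^ 3)
    1 (-3 / 5) (1 / 8) (-1 / 112) 0 (fun x => by ring) x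
  have h₂ := ((hasDerivAt_id' x).const_mul (2 / 5)).fun_mul dw
  have h := (((hasDerivAt_P₄ x).fun_pow 3).fun_mul (h₁.fun_sub h₂)).fun_div
    ((hasDerivAt_R₁ x).fun_mul ((hasDerivAt_Q₄ x).fun_pow 2)) (mul_ne_zero hR₁ (pow_ne_zero 2 hQ))
  refine h.congr_deriv ?_
  rw [dihFactor₂]
  field_simp
  push_cast
  ring

/-- The three contiguous dihedral functions satisfy the pulled back contiguity system, up to the
exponent `σ` by which the radical prefactor is twisted. -/
theorem dih_pullOp_relations {w ρ : ℂ → ℂ} {x σ : ℂ} (hw : w x ^ 2 = R₁ x * R₂ x)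
    (dw : HasDerivAt w (w x * sqrtLogDeriv x) x)
    (hR₁ : R₁ x ≠ 0) (hR₂ : R₂ x ≠ 0) (hP : P₄ x ≠ 0) (hQ : Q₄ x ≠ 0) (hH : ramPoly x ≠ 0)
    (hx : x ≠ 0) (hx5 : x - 5 ≠ 0)
    (dρ : HasDerivAt ρ (ρ x * (dihLogDeriv x (w x) + σ / (x * coverMult x))) x) :
    1 / 4 * (1 / 2) * pullOp coverMult (0 - σ) (fun x => ρ x * dihFactor₀ x (w x)) x =
      -3 / 28 * (1 / 28) *
        (Psi₄ x * pullOp coverMult (9 / 28 - σ) (fun x => ρ x * dihFactor₂ x (w x)) x) ∧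
    -3 / 28 * pullOp coverMult (1 / 4 - σ) (fun x => ρ x * dihFactor₁ x (w x)) x =
      1 / 4 * pullOp coverMult (-3 / 28 - σ) (fun x => ρ x * dihFactor₀ x (w x)) x ∧
    1 / 28 * pullOp coverMult (1 / 2 - σ) (fun x => ρ x * dihFactor₂ x (w x)) x =
      1 / 2 * pullOp coverMult (1 / 28 - σ) (fun x => ρ x * dihFactor₁ x (w x)) x := by
  have hm : coverMult x ≠ 0 := div_ne_zero (mul_ne_zero (mul_ne_zero hR₁ hQ) hP) hH
  -- The twist adds σ/(x m) to the logarithmic derivative, hence σ after multiplication by x m; this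
  -- cancels the shift c - σ.
  have op {f : ℂ → ℂ} {f' : ℂ} (df : HasDerivAt f f' x) (c : ℂ) :
      pullOp coverMult (c - σ) (fun x => ρ x * f x) x =
        ρ x * (x * coverMult x * (f' + dihLogDeriv x (w x) * f x) + c * f x) := by
    rw [pullOp_mul dρ df]
    field_simp
    ring
  rw [op (hasDerivAt_dihFactor₀ dw), op (hasDerivAt_dihFactor₂ hQ hR₁ hP dw),
    op (hasDerivAt_dihFactor₁ hQ hR₁ hP dw), op (hasDerivAt_dihFactor₀ dw),
    op (hasDerivAt_dihFactor₂ hQ hR₁ hP dw), op (hasDerivAt_dihFactor₁ hQ hR₁ hP dw)]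
  generalize w x = v at *
  generalize ρ x = r
  have cancel {c d e f g : ℂ} (h : c * d = e * (f * g)) : c * (r * d) = e * (f * (r * g)) := by
    linear_combination r * h
  have cancel' {c d e g : ℂ} (h : c * d = e * g) : c * (r * d) = e * (r * g) := by
    linear_combination r * h
  refine ⟨cancel ?_, cancel' ?_, cancel' ?_⟩
  · rw [Psi₄_eq]
    -- The w² term is the w-part of `dihLogDeriv` times the w-parts of the factors; the multiplier
    -- replaces w² by R₁R₂ there, and likewise in the two relations below.
    linear_combination (norm := skip) (-(x * coverMult x) * (1 / 4 * (1 / 2) * (1 / 2) -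
      -3 / 28 * (1 / 28) * (-343 / 32 * (x * R₁ x ^ 2 * Q₄ x ^ 4 / P₄ x ^ 7)) *
        (P₄ x ^ 3 * (-2 / 5 * x) / (R₁ x * Q₄ x ^ 2))) *
      (5 / 4 - 3 / 4 * x + 5 / 32 * x ^ 2 - 5 / 448 * x ^ 3) / (R₁ x * R₂ x) / (x * (x - 5))) * hw
    rw [coverMult, dihLogDeriv, sqrtLogDeriv, dihFactor₀, dihFactor₂]
    field_simp
    simp only [R₁, R₂, P₄, Q₄, ramPoly, dihP]
    ring
  · linear_combination (norm := skip) (-(x * coverMult x) * (-3 / 28 *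
        (P₄ x * (1 / 2 - 5 / 24 * x + 1 / 48 * x ^ 2) / (Q₄ x * R₁ x)) - 1 / 4 * (1 / 2)) *
      (5 / 4 - 3 / 4 * x + 5 / 32 * x ^ 2 - 5 / 448 * x ^ 3) / (R₁ x * R₂ x) / (x * (x - 5))) * hw
    rw [coverMult, dihLogDeriv, sqrtLogDeriv, dihFactor₀, dihFactor₁]
    field_simp
    simp only [R₁, R₂, P₄, Q₄, ramPoly, dihP]
    ring
  · linear_combination (norm := skip) (-(x * coverMult x) * (1 / 28 *
        (P₄ x ^ 3 * (-2 / 5 * x) / (R₁ x * Q₄ x ^ 2)) -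
        1 / 2 * (P₄ x * (1 / 2 - 5 / 24 * x + 1 / 48 * x ^ 2) / (Q₄ x * R₁ x))) *
      (5 / 4 - 3 / 4 * x + 5 / 32 * x ^ 2 - 5 / 448 * x ^ 3) / (R₁ x * R₂ x) / (x * (x - 5))) * hw
    rw [coverMult, dihLogDeriv, sqrtLogDeriv, dihFactor₁, dihFactor₂]
    field_simp
    simp only [R₁, R₂, P₄, Q₄, ramPoly]
    ring

/-! ### Companion solutions and contiguous parameters -/

theorem notNonposInt_div (p : ℤ) (q : ℕ) (hq : q ≠ 0) (h : ¬ (q : ℤ) ∣ p) :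
    NotNonposInt ((p : ℂ) / q) := fun n hn => by
  have hq' : (q : ℂ) ≠ 0 := by exact_mod_cast hq
  field_simp at hn
  have hn' : (n : ℤ) * q + p = 0 := by exact_mod_cast hn
  exact h ⟨-n, by linear_combination hn'⟩

theorem hyp3F2_rotate (a b c : ℂ) (d : Fin 2 → ℂ) : hyp3F2 ![a, b, c] d = hyp3F2 ![b, c, a] d := by
  funext z
  refine tsum_congr fun n => ?_
  simp only [Fin.prod_univ_three, Matrix.cons_val_zero, Matrix.cons_val_one, Matrix.cons_val]
  ring

theorem hyp3F2_swap (a : Fin 3 → ℂ) (d e : ℂ) : hyp3F2 a ![d, e] = hyp3F2 a ![e, d] := by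
  funext z
  refine tsum_congr fun n => ?_
  simp only [Fin.prod_univ_two, Matrix.cons_val_zero, Matrix.cons_val_one]
  ring

theorem isHypSolutionOn_companions :
    IsHypSolutionOn ![-3 / 28, 1 / 28, 9 / 28] ![1 / 4, 1 / 2] slitDisc
        (hyp3F2 ![-3 / 28, 1 / 28, 9 / 28] ![1 / 4, 1 / 2]) ∧
      IsHypSolutionOn ![-3 / 28, 1 / 28, 9 / 28] ![1 / 4, 1 / 2] slitDisc
        (fun z => z ^ (1 / 2 : ℂ) * hyp3F2 ![11 / 28, 15 / 28, 23 / 28] ![3 / 4, 3 / 2] z) ∧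
      IsHypSolutionOn ![-3 / 28, 1 / 28, 9 / 28] ![1 / 4, 1 / 2] slitDisc
        (fun z => z ^ (3 / 4 : ℂ) * hyp3F2 ![9 / 14, 11 / 14, 15 / 14] ![5 / 4, 7 / 4] z) := by
  have nn {c : ℂ} (p : ℤ) (q : ℕ) (hc : c = p / q) (hq : q ≠ 0) (h : ¬ (q : ℤ) ∣ p) :
      NotNonposInt c := hc ▸ notNonposInt_div p q hq h
  have three {a b c : ℂ} (ha : NotNonposInt a) (hb : NotNonposInt b) (hc : NotNonposInt c) :
      ∀ i, NotNonposInt (![a, b, c] i) := fun i => by fin_cases i <;> simpa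
  have two {a b : ℂ} (ha : NotNonposInt a) (hb : NotNonposInt b) :
      ∀ i, NotNonposInt (![a, b] i) := fun i => by fin_cases i <;> simpa
  refine ⟨?_, ?_, ?_⟩
  · have hb := two (nn (c := 1 / 4) 1 4 (by norm_num) (by norm_num) (by norm_num))
      (nn (c := 1 / 2) 1 2 (by norm_num) (by norm_num) (by norm_num))
    have ha := three (nn (c := -3 / 28) (-3) 28 (by norm_num) (by norm_num) (by norm_num))
      (nn (c := 1 / 28) 1 28 (by norm_num) (by norm_num) (by norm_num))
      (nn (c := 9 / 28) 9 28 (by norm_num) (by norm_num) (by norm_num))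
    have := isHypSolutionOn_cpow_mul (a := ![-3 / 28, 1 / 28, 9 / 28]) (b := ![1 / 4, 1 / 2])
      (s := 0) (convergesOnDisc_hypCoeff ha hb) (by simp) (fun n => by
        have := hypCoeff_succ ![-3 / 28, 1 / 28, 9 / 28] hb n
        simpa using this)
    simp only [Complex.cpow_zero, one_mul] at this
    exact this
  · have hb := two (nn (c := 3 / 4) 3 4 (by norm_num) (by norm_num) (by norm_num))
      (nn (c := 3 / 2) 3 2 (by norm_num) (by norm_num) (by norm_num))
    have ha := three (nn (c := 11 / 28) 11 28 (by norm_num) (by norm_num) (by norm_num))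
      (nn (c := 15 / 28) 15 28 (by norm_num) (by norm_num) (by norm_num))
      (nn (c := 23 / 28) 23 28 (by norm_num) (by norm_num) (by norm_num))
    simp only [hyp3F2_eq_powSum]
    refine isHypSolutionOn_cpow_mul (convergesOnDisc_hypCoeff ha hb)
      (by simp only [Matrix.cons_val_zero, Matrix.cons_val_one]; norm_num) (fun n => ?_)
    have := hypCoeff_succ ![11 / 28, 15 / 28, 23 / 28] hb n
    simp only [Matrix.cons_val_zero, Matrix.cons_val_one, Matrix.cons_val] at this ⊢
    linear_combination this
  · have hb := two (nn (c := 5 / 4) 5 4 (by norm_num) (by norm_num) (by norm_num))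
      (nn (c := 7 / 4) 7 4 (by norm_num) (by norm_num) (by norm_num))
    have ha := three (nn (c := 9 / 14) 9 14 (by norm_num) (by norm_num) (by norm_num))
      (nn (c := 11 / 14) 11 14 (by norm_num) (by norm_num) (by norm_num))
      (nn (c := 15 / 14) 15 14 (by norm_num) (by norm_num) (by norm_num))
    simp only [hyp3F2_eq_powSum]
    refine isHypSolutionOn_cpow_mul (convergesOnDisc_hypCoeff ha hb)
      (by simp only [Matrix.cons_val_zero, Matrix.cons_val_one]; norm_num) (fun n => ?_)
    have := hypCoeff_succ ![9 / 14, 11 / 14, 15 / 14] hb n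
    simp only [Matrix.cons_val_zero, Matrix.cons_val_one, Matrix.cons_val] at this ⊢
    linear_combination this

theorem contiguous_radical :
    Contiguous ![-3 / 14, 1 / 14, 9 / 14] ![1 / 4, 3 / 4]
        ![9 / 14, 11 / 14, 15 / 14] ![5 / 4, 7 / 4] ∧
      Contiguous ![-3 / 14, 1 / 14, 9 / 14] ![1 / 4, 3 / 4]
        ![1 / 14, 9 / 14, 11 / 14] ![3 / 4, 5 / 4] := by
  refine ⟨⟨⟨finRotate 3, fun i => ⟨![1, 1, 0] i, ?_⟩⟩, ⟨1, fun j => ⟨1, ?_⟩⟩⟩,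
    ⟨⟨(finRotate 3).symm, fun i => ⟨![1, 0, 0] i, ?_⟩⟩,
      ⟨Equiv.swap 0 1, fun j => ⟨![1, 0] j, ?_⟩⟩⟩⟩
  · fin_cases i <;> simp <;> norm_num
  · fin_cases j <;> (simp; norm_num)
  · obtain ⟨k, rfl⟩ := (finRotate 3).surjective i
    rw [Equiv.symm_apply_apply]
    fin_cases k <;> simp <;> norm_num
  · fin_cases j <;> simp <;> norm_num

/-! ### The three radical evaluations -/

theorem radical_evaluations :
    (∀ᶠ x in 𝓝 (0 : ℂ),
      hyp3F2 ![9 / 14, 11 / 14, 15 / 14] ![5 / 4, 7 / 4] (Psi₄ x) =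
        P₄ x ^ (9 / 2 : ℂ) / (Q₄ x ^ 3 * R₁ x ^ (3 / 2 : ℂ)) * (1 - 3 / 14 * x)) ∧
    (∀ᶠ x in 𝓝 (0 : ℂ),
      hyp3F2 ![1 / 14, 9 / 14, 11 / 14] ![3 / 4, 5 / 4] (Psi₄ x) =
        P₄ x ^ (1 / 2 : ℂ) / (Q₄ x * R₁ x ^ (1 / 2 : ℂ)) *
          (1 - 3 / 5 * x + 1 / 8 * x ^ 2 - 1 / 112 * x ^ 3)) ∧
    (∀ᶠ x in 𝓝 (0 : ℂ),
      hyp3F2 ![-3 / 14, 1 / 14, 9 / 14] ![1 / 4, 3 / 4] (Psi₄ x) =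
        R₁ x ^ (1 / 2 : ℂ) / P₄ x ^ (3 / 2 : ℂ) *
          (1 - 3 / 4 * x + 1 / 4 * x ^ 2 - 3 / 112 * x ^ 3)) := by
  have nn {c : ℂ} (p : ℤ) (q : ℕ) (hc : c = p / q) (hq : q ≠ 0) (h : ¬ (q : ℤ) ∣ p) :
      NotNonposInt c := hc ▸ notNonposInt_div p q hq h
  have aP := analyticAt_P₄ 0
  have aQ := analyticAt_Q₄ 0
  have aR := analyticAt_R₁ 0
  have aρ : AnalyticAt ℂ (fun x => R₁ x ^ (1 / 2 : ℂ) * P₄ x ^ (-1 / 2 : ℂ)) 0 :=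
    (analyticAt_cpow_const aR R₁_zero _).mul (analyticAt_cpow_const aP P₄_zero _)
  have n₀ : AnalyticAt ℂ (fun x : ℂ => 1 - 3 / 4 * x + 1 / 4 * x ^ 2 - 3 / 112 * x ^ 3) 0 := by
    fun_prop
  have n₁ : AnalyticAt ℂ (fun x : ℂ => 1 - 3 / 5 * x + 1 / 8 * x ^ 2 - 1 / 112 * x ^ 3) 0 := by
    fun_prop
  have n₂ : AnalyticAt ℂ (fun x : ℂ => 1 - 3 / 14 * x) 0 := by fun_prop
  -- One triple yields all three evaluations: up to reordering, its members are the three ₃F₂ of the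
  -- statement.
  have h := hyp_Psi₄_of_isPulledSystemAt (a₁ := -3 / 14) (a₂ := 1 / 14) (a₃ := 9 / 14)
    (c₁ := 1 / 4) (c₂ := 3 / 4)
    (nn (-3) 14 (by norm_num) (by norm_num) (by norm_num))
    (nn 1 14 (by norm_num) (by norm_num) (by norm_num))
    (nn 9 14 (by norm_num) (by norm_num) (by norm_num))
    (nn 1 4 (by norm_num) (by norm_num) (by norm_num))
    (nn 3 4 (by norm_num) (by norm_num) (by norm_num))
    (aρ.fun_mul (n₀.fun_div aP (by simp [P₄_zero])))
    (aρ.fun_mul ((aP.fun_mul n₁).fun_div (aQ.fun_mul aR) (by simp [Q₄_zero, R₁_zero])))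
    (aρ.fun_mul (((aP.fun_pow 5).fun_mul n₂).fun_div
      ((aQ.fun_pow 3).fun_mul (aR.fun_pow 2)) (by simp [Q₄_zero, R₁_zero])))
    (by
      filter_upwards [nhdsWithin_le_nhds (eventually_mem_slitPlane aP P₄_zero),
        nhdsWithin_le_nhds (eventually_mem_slitPlane aR R₁_zero),
        nhdsWithin_le_nhds eventually_Q₄_ne_zero, nhdsWithin_le_nhds eventually_ramPoly_ne_zero]
        with x hP hR hQ hH
      exact radical_isPulledSystemAt hP hR hQ hH)
  rw [show (-3 / 14 + 1 : ℂ) = 11 / 14 by norm_num, show (1 / 14 + 1 : ℂ) = 15 / 14 by norm_num,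
    show (1 / 4 + 1 : ℂ) = 5 / 4 by norm_num, show (3 / 4 + 1 : ℂ) = 7 / 4 by norm_num] at h
  simp only [P₄_zero, R₁_zero, Complex.one_cpow, mul_zero, ne_eq, OfNat.ofNat_ne_zero,
    not_false_eq_true, zero_pow, sub_zero, add_zero, div_one, one_mul] at h
  have key : ∀ᶠ x in 𝓝 (0 : ℂ), P₄ x ≠ 0 ∧ R₁ x ≠ 0 ∧ Q₄ x ≠ 0 :=
    eventually_P₄_ne_zero.and (eventually_R₁_ne_zero.and eventually_Q₄_ne_zero)
  have neg {y : ℂ} : y ^ (-1 / 2 : ℂ) = (y ^ (1 / 2 : ℂ))⁻¹ := by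
    rw [← Complex.cpow_neg, neg_div]
  have sq {y : ℂ} (hy : y ≠ 0) : (y ^ (1 / 2 : ℂ)) ^ 2 = y := by
    rw [sq, ← Complex.cpow_add _ _ hy]
    norm_num
  have three {y : ℂ} (hy : y ≠ 0) : y ^ (3 / 2 : ℂ) = y * y ^ (1 / 2 : ℂ) := by
    rw [show (3 / 2 : ℂ) = 1 + 1 / 2 by norm_num, Complex.cpow_add _ _ hy, Complex.cpow_one]
  have nine {y : ℂ} (hy : y ≠ 0) : y ^ (9 / 2 : ℂ) = y ^ 4 * y ^ (1 / 2 : ℂ) := by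
    rw [show (9 / 2 : ℂ) = (4 : ℕ) + 1 / 2 by norm_num, Complex.cpow_add _ _ hy,
      Complex.cpow_natCast]
  have ne {y : ℂ} (hy : y ≠ 0) : y ^ (1 / 2 : ℂ) ≠ 0 := by simp [Complex.cpow_eq_zero_iff, hy]
  refine ⟨?_, ?_, ?_⟩
  · filter_upwards [h, key] with x hx ⟨hP, hR, hQ⟩
    have sP := sq hP
    have sR := sq hR
    rw [hyp3F2_rotate, ← hx.2.2, neg, three hR, nine hP]
    have nP := ne hP
    have nR := ne hR
    generalize P₄ x ^ (1 / 2 : ℂ) = p at sP nP ⊢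
    generalize R₁ x ^ (1 / 2 : ℂ) = r at sR nR ⊢
    rw [← sP, ← sR]
    field_simp
  · filter_upwards [h, key] with x hx ⟨hP, hR, hQ⟩
    have sP := sq hP
    have sR := sq hR
    rw [hyp3F2_rotate, hyp3F2_rotate, hyp3F2_swap, ← hx.2.1, neg]
    have nP := ne hP
    have nR := ne hR
    generalize P₄ x ^ (1 / 2 : ℂ) = p at sP nP ⊢
    generalize R₁ x ^ (1 / 2 : ℂ) = r at sR nR ⊢
    rw [← sP, ← sR]
    field_simp
  · filter_upwards [h, key] with x hx ⟨hP, hR, hQ⟩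
    rw [← hx.1, neg, three hP]
    field_simp [ne hP]

/-! ### The first dihedral evaluation -/

theorem analyticAt_sqrtR : AnalyticAt ℂ sqrtR 0 :=
  analyticAt_cpow_const ((analyticAt_R₁ 0).fun_mul (analyticAt_R₂ 0)) (by simp [R₁_zero, R₂_zero]) _

theorem sqrtR_zero : sqrtR 0 = 1 := by simp [sqrtR, R₁_zero, R₂_zero]

theorem sqrtR_sq {x : ℂ} (h₁ : R₁ x ≠ 0) (h₂ : R₂ x ≠ 0) : sqrtR x ^ 2 = R₁ x * R₂ x := by
  rw [sqrtR, sq, ← Complex.cpow_add _ _ (mul_ne_zero h₁ h₂)]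
  norm_num

theorem hasDerivAt_sqrtR {x : ℂ} (h : R₁ x * R₂ x ∈ Complex.slitPlane) :
    HasDerivAt sqrtR (sqrtR x * sqrtLogDeriv x) x := by
  have h0 := mul_ne_zero_iff.1 (Complex.slitPlane_ne_zero h)
  have h1 := h0.1
  have h2 := h0.2
  refine (hasDerivAt_cpow_const ((hasDerivAt_R₁ x).fun_mul (hasDerivAt_R₂ x)) h _).congr_deriv ?_
  rw [sqrtLogDeriv, sqrtR]
  field_simp

theorem eventually_R₁_mul_R₂_mem_slitPlane : ∀ᶠ x in 𝓝 0, R₁ x * R₂ x ∈ Complex.slitPlane :=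
  eventually_mem_slitPlane ((analyticAt_R₁ 0).fun_mul (analyticAt_R₂ 0))
    (by simp [R₁_zero, R₂_zero])

theorem analyticAt_dihQ (x : ℂ) : AnalyticAt ℂ dihQ x :=
  Differentiable.analyticAt (fun x => (hasDerivAt_dihQ x).differentiableAt) x

theorem analyticAt_dihFactors {w : ℂ → ℂ} (hw : AnalyticAt ℂ w 0) :
    AnalyticAt ℂ (fun x => dihFactor₀ x (w x)) 0 ∧ AnalyticAt ℂ (fun x => dihFactor₁ x (w x)) 0 ∧
      AnalyticAt ℂ (fun x => dihFactor₂ x (w x)) 0 := by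
  have aP := analyticAt_P₄ 0
  have aQ := analyticAt_Q₄ 0
  have aR := analyticAt_R₁ 0
  have p₀ : AnalyticAt ℂ dihP 0 :=
    Differentiable.analyticAt (fun x => (hasDerivAt_dihP x).differentiableAt) 0
  have p₁ : AnalyticAt ℂ
    (fun x : ℂ => 1 / 2 - 11 / 48 * x + 17 / 1344 * x ^ 3 - 1 / 672 * x ^ 4) 0 := by fun_prop
  have q₁ : AnalyticAt ℂ (fun x : ℂ => 1 / 2 - 5 / 24 * x + 1 / 48 * x ^ 2) 0 := by fun_prop
  have p₂ : AnalyticAt ℂ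
    (fun x : ℂ => 1 - 3 / 5 * x + 1 / 8 * x ^ 2 - 1 / 112 * x ^ 3) 0 := by fun_prop
  have q₂ : AnalyticAt ℂ (fun x : ℂ => 2 / 5 * x) 0 := by fun_prop
  exact ⟨p₀.fun_add (analyticAt_const.fun_mul hw),
    (aP.fun_mul ((p₁.fun_mul aR).fun_add (q₁.fun_mul hw))).fun_div (aQ.fun_mul aR)
      (by simp [Q₄_zero, R₁_zero]),
    ((aP.fun_pow 3).fun_mul (p₂.fun_sub (q₂.fun_mul hw))).fun_div (aR.fun_mul (aQ.fun_pow 2))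
      (by simp [Q₄_zero, R₁_zero])⟩

theorem dihedral_evaluation : ∀ᶠ x in 𝓝 (0 : ℂ),
    hyp3F2 ![-3 / 28, 1 / 28, 9 / 28] ![1 / 4, 1 / 2] (Psi₄ x) =
      (1 / 2 * sqrtR x + 1 / 2 - 15 / 32 * x + 53 / 448 * x ^ 2 - 1 / 112 * x ^ 3) /
        (P₄ x ^ (3 / 4 : ℂ) * K₁ x) := by
  have nn {c : ℂ} (p : ℤ) (q : ℕ) (hc : c = p / q) (hq : q ≠ 0) (h : ¬ (q : ℤ) ∣ p) :
      NotNonposInt c := hc ▸ notNonposInt_div p q hq h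
  have aP := analyticAt_P₄ 0
  have ak : AnalyticAt ℂ (fun x => 1 / 2 * sqrtR x + dihQ x) 0 :=
    (analyticAt_const.fun_mul analyticAt_sqrtR).fun_add (analyticAt_dihQ 0)
  have k0 : 1 / 2 * sqrtR 0 + dihQ 0 = 1 := by
    rw [sqrtR_zero, dihQ]
    norm_num
  have aρ : AnalyticAt ℂ
      (fun x => P₄ x ^ (-3 / 4 : ℂ) * (1 / 2 * sqrtR x + dihQ x) ^ (-1 / 4 : ℂ)) 0 :=
    (analyticAt_cpow_const aP P₄_zero _).fun_mul (analyticAt_cpow_const ak k0 _)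
  obtain ⟨f₀, f₁, f₂⟩ := analyticAt_dihFactors analyticAt_sqrtR
  have h := hyp_Psi₄_of_isPulledSystemAt (a₁ := -3 / 28) (a₂ := 1 / 28) (a₃ := 9 / 28)
    (c₁ := 1 / 4) (c₂ := 1 / 2)
    (nn (-3) 28 (by norm_num) (by norm_num) (by norm_num))
    (nn 1 28 (by norm_num) (by norm_num) (by norm_num))
    (nn 9 28 (by norm_num) (by norm_num) (by norm_num))
    (nn 1 4 (by norm_num) (by norm_num) (by norm_num))
    (nn 1 2 (by norm_num) (by norm_num) (by norm_num))
    (aρ.fun_mul f₀) (aρ.fun_mul f₁) (aρ.fun_mul f₂) (by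
      filter_upwards [nhdsWithin_le_nhds (eventually_mem_slitPlane aP P₄_zero),
        nhdsWithin_le_nhds (eventually_mem_slitPlane ak k0),
        nhdsWithin_le_nhds eventually_R₁_mul_R₂_mem_slitPlane,
        nhdsWithin_le_nhds eventually_Q₄_ne_zero, nhdsWithin_le_nhds eventually_ramPoly_ne_zero,
        nhdsWithin_le_nhds (eventually_ne_nhds (show (0 : ℂ) ≠ 5 by norm_num)),
        self_mem_nhdsWithin] with x hP hk hR hQ hH hx5 hx
      obtain ⟨hR₁, hR₂⟩ := mul_ne_zero_iff.1 (Complex.slitPlane_ne_zero hR)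
      have hx5 : x - 5 ≠ 0 := sub_ne_zero.2 hx5
      have hw := sqrtR_sq hR₁ hR₂
      have dw := hasDerivAt_sqrtR hR
      have dρ := hasDerivAt_cpow_mul_cpow (hasDerivAt_P₄ x)
        ((dw.const_mul (1 / 2)).fun_add (hasDerivAt_dihQ x)) hP hk (-3 / 4) (-1 / 4)
      -- The denominator x(x - 5) of this formula is why the relations are checked only for x ≠ 0.
      rw [dihQ_logDeriv hw hR₁ hR₂ (Complex.slitPlane_ne_zero hk) hx hx5] at dρ
      have := dih_pullOp_relations (σ := 0) hw dw hR₁ hR₂ (Complex.slitPlane_ne_zero hP) hQ hH hx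
        hx5 (dρ.congr_deriv (by rw [dihLogDeriv, zero_div]; ring))
      simp only [sub_zero] at this
      exact this)
  have f0 : dihFactor₀ 0 (sqrtR 0) = 1 := by
    rw [dihFactor₀, dihP, sqrtR_zero]
    norm_num
  simp only [P₄_zero, k0, f0, Complex.one_cpow, one_mul] at h
  filter_upwards [h] with x hx
  have e : (1 / 2 * sqrtR x + 1 / 2 - 45 / 128 * x + 5 / 64 * x ^ 2 - 5 / 896 * x ^ 3) =
    1 / 2 * sqrtR x + dihQ x := by rw [dihQ]; ring
  have e' : (1 / 2 * sqrtR x + 1 / 2 - 15 / 32 * x + 53 / 448 * x ^ 2 - 1 / 112 * x ^ 3) =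
    dihFactor₀ x (sqrtR x) := by rw [dihFactor₀, dihP]; ring
  rw [← hx.1, K₁, e, e', neg_div, neg_div, Complex.cpow_neg, Complex.cpow_neg, ← mul_inv,
    div_eq_inv_mul (dihFactor₀ _ _)]

/-! ### The companion dihedral evaluation -/

theorem exists_analyticAt_eq_mul {f : ℂ → ℂ} (hf : AnalyticAt ℂ f 0) (h : f 0 = 0) :
    ∃ g : ℂ → ℂ, AnalyticAt ℂ g 0 ∧ ∀ᶠ x in 𝓝 0, f x = x * g x := by
  have h1 : ((1 : ℕ) : ℕ∞) ≤ analyticOrderAt f 0 := by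
    rw [Nat.cast_one, Order.one_le_iff_ne_zero]
    exact hf.analyticOrderAt_ne_zero.2 h
  obtain ⟨g, hg, hfg⟩ := (natCast_le_analyticOrderAt hf).1 h1
  exact ⟨g, hg, hfg.mono fun x hx => by simpa using hx⟩

theorem IsPulledSystemAt.congr {m Ψ : ℂ → ℂ} {a₁ a₂ a₃ c₁ c₂ x : ℂ} {Y₀ Y₁ Y₂ Z₀ Z₁ Z₂ : ℂ → ℂ}
    (h : IsPulledSystemAt m Ψ a₁ a₂ a₃ c₁ c₂ Y₀ Y₁ Y₂ x) (h₀ : Z₀ =ᶠ[𝓝 x] Y₀)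
    (h₁ : Z₁ =ᶠ[𝓝 x] Y₁) (h₂ : Z₂ =ᶠ[𝓝 x] Y₂) :
    IsPulledSystemAt m Ψ a₁ a₂ a₃ c₁ c₂ Z₀ Z₁ Z₂ x := by
  have e {f g : ℂ → ℂ} (hfg : f =ᶠ[𝓝 x] g) (c : ℂ) : pullOp m c f x = pullOp m c g x := by
    rw [pullOp, pullOp, hfg.deriv_eq, hfg.eq_of_nhds]
  rwa [IsPulledSystemAt, e h₀, e h₀, e h₁, e h₁, e h₂, e h₂]

theorem pullOp_const_mul (m : ℂ → ℂ) (c k : ℂ) (f : ℂ → ℂ) (x : ℂ) :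
    pullOp m c (fun x => k * f x) x = k * pullOp m c f x := by
  rw [pullOp, pullOp, deriv_const_mul_field]
  ring

/-- Since x m Ψ' = Ψ, multiplication by Ψ raises the exponent by 1, as multiplication by z does for
z d/dz. -/
theorem pullOp_cover_mul {m Ψ f : ℂ → ℂ} {x : ℂ} (hΨ : DifferentiableAt ℂ Ψ x)
    (hx : x * m x * deriv Ψ x = Ψ x) (hf : DifferentiableAt ℂ f x) (c : ℂ) :
    pullOp m c (fun x => Ψ x * f x) x = Ψ x * pullOp m (c + 1) f x := by
  rw [pullOp, pullOp, (hΨ.hasDerivAt.fun_mul hf.hasDerivAt).deriv]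
  linear_combination f x * hx

/-- The base of the fourth root `K₂`. -/
def k₂Base (x : ℂ) : ℂ :=
  (sqrtR x - 1 + 45 / 64 * x - 5 / 32 * x ^ 2 + 5 / 448 * x ^ 3) / (625 / 57344 * x ^ 2)

theorem k₂Base_eq (x : ℂ) :
    k₂Base x = -2 * (1 / 2 * -sqrtR x + dihQ x) / (625 / 57344 * x ^ 2) := by
  rw [k₂Base, dihQ]
  congr 1
  ring

/-- The analytic continuation of `k₂Base` to `x = 0`. -/
def k₂Ext (x : ℂ) : ℂ := 2 * (1 - 1 / 5 * x) ^ 4 / (sqrtR x + 2 * dihQ x)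

theorem k₂Ext_zero : k₂Ext 0 = 1 := by
  rw [k₂Ext, sqrtR_zero, dihQ]
  norm_num

theorem analyticAt_sqrtR_add_dihQ : AnalyticAt ℂ (fun x => sqrtR x + 2 * dihQ x) 0 :=
  analyticAt_sqrtR.fun_add (analyticAt_const.fun_mul (analyticAt_dihQ 0))

theorem sqrtR_add_dihQ_zero : sqrtR 0 + 2 * dihQ 0 ≠ 0 := by
  rw [sqrtR_zero, dihQ]
  norm_num

theorem analyticAt_k₂Ext : AnalyticAt ℂ k₂Ext 0 :=
  AnalyticAt.fun_div (f := fun x : ℂ => 2 * (1 - 1 / 5 * x) ^ 4) (by fun_prop)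
    analyticAt_sqrtR_add_dihQ sqrtR_add_dihQ_zero

/-- Rationalization: (w - 2`dihQ`)(w + 2`dihQ`) = R₁R₂ - 4`dihQ`² = 2·(625/57344) x²(1 - x/5)⁴. -/
theorem k₂Base_eq_k₂Ext : ∀ᶠ x in 𝓝[≠] 0, k₂Base x = k₂Ext x := by
  filter_upwards [nhdsWithin_le_nhds (eventually_ne_zero analyticAt_sqrtR_add_dihQ
    sqrtR_add_dihQ_zero), nhdsWithin_le_nhds eventually_R₁_ne_zero,
    nhdsWithin_le_nhds eventually_R₂_ne_zero, self_mem_nhdsWithin] with x hk h₁ h₂ hx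
  have hx : x ≠ 0 := hx
  have hs := sqrtR_sq h₁ h₂
  rw [k₂Base_eq, k₂Ext, div_eq_div_iff (by simp [hx]) hk]
  linear_combination (norm := skip) hs
  simp only [dihQ, R₁, R₂]
  ring

/-- The radical prefactor of the second dihedral evaluation, away from `x = 0`. -/
def dihTwist (x : ℂ) : ℂ :=
  P₄ x ^ (11 / 4 : ℂ) * k₂Base x ^ (-1 / 4 : ℂ) / (Q₄ x ^ 2 * R₁ x * x)

/-- Up to a constant and the choice of branches, `dihTwist` is the conjugate prefactor
P₄^(-3/4)(-w/2 + `dihQ`)^(-1/4), w = `sqrtR`, times Ψ₄^(-1/2). Each of the last two factors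
contributes x^(-1/2), so only a simple pole remains. The summand -1/2 over x m is the logarithmic
derivative of Ψ₄^(-1/2). -/
theorem hasDerivAt_dihTwist {x : ℂ} (hP : P₄ x ∈ Complex.slitPlane)
    (hk : k₂Base x ∈ Complex.slitPlane) (hR : R₁ x * R₂ x ∈ Complex.slitPlane) (hQ : Q₄ x ≠ 0)
    (hx : x ≠ 0) (hx5 : x - 5 ≠ 0) :
    HasDerivAt dihTwist
      (dihTwist x * (dihLogDeriv x (-sqrtR x) + (-1 / 2) / (x * coverMult x))) x := by
  obtain ⟨hR₁, hR₂⟩ := mul_ne_zero_iff.1 (Complex.slitPlane_ne_zero hR)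
  have hP0 := Complex.slitPlane_ne_zero hP
  have hk0 := Complex.slitPlane_ne_zero hk
  have hk' : 1 / 2 * -sqrtR x + dihQ x ≠ 0 := fun h => hk0 (by rw [k₂Base_eq, h]; simp)
  have hc : (625 / 57344 * x ^ 2 : ℂ) ≠ 0 := by simp [hx]
  have dw := (hasDerivAt_sqrtR hR).fun_neg
  have dk : HasDerivAt k₂Base (k₂Base x * ((1 / 2 * (-sqrtR x * sqrtLogDeriv x) +
      (-45 / 128 + 5 / 32 * x - 15 / 896 * x ^ 2)) / (1 / 2 * -sqrtR x + dihQ x) - 2 / x)) x := by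
    have h := (((dw.const_mul (1 / 2)).fun_add (hasDerivAt_dihQ x)).const_mul (-2)).fun_div
      ((hasDerivAt_pow 2 x).const_mul (625 / 57344)) hc
    rw [show k₂Base = fun x => -2 * (1 / 2 * -sqrtR x + dihQ x) / (625 / 57344 * x ^ 2) from
      funext k₂Base_eq]
    refine h.congr_deriv ?_
    beta_reduce
    generalize 1 / 2 * -sqrtR x + dihQ x = k at hk' ⊢
    field_simp
    push_cast
    ring
  rw [dihQ_logDeriv (by rw [neg_sq, sqrtR_sq hR₁ hR₂]) hR₁ hR₂ hk' hx hx5] at dk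
  have h := (hasDerivAt_cpow_mul_cpow (hasDerivAt_P₄ x) dk hP hk (11 / 4) (-1 / 4)).fun_div
    ((((hasDerivAt_Q₄ x).fun_pow 2).fun_mul (hasDerivAt_R₁ x)).fun_mul (hasDerivAt_id' x))
    (mul_ne_zero (mul_ne_zero (pow_ne_zero 2 hQ) hR₁) hx)
  refine h.congr_deriv ?_
  rw [dihTwist, dihLogDeriv, coverMult]
  have hd (y : ℂ) : k₂Base x * y / k₂Base x = y := by field_simp
  rw [hd]
  generalize P₄ x ^ (11 / 4 : ℂ) * k₂Base x ^ (-1 / 4 : ℂ) = r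
  generalize (3 / 4 * x - 5 / 4 + (5 / 4 - 3 / 4 * x + 5 / 32 * x ^ 2 - 5 / 448 * x ^ 3) *
      -sqrtR x / (R₁ x * R₂ x)) / (x * (x - 5)) = t
  have e : ramPoly x = R₁ x * Q₄ x * P₄ x + x * (2 * (-3 / 8 + 1 / 14 * x) * Q₄ x * P₄ x +
      4 * (-1 / 2 + 1 / 14 * x + 3 / 56 * x ^ 2 - 1 / 98 * x ^ 3) * R₁ x * P₄ x -
      7 * (-1 + 1 / 2 * x - 3 / 56 * x ^ 2) * R₁ x * Q₄ x) := by
    rw [ramPoly, R₁, Q₄, P₄]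
    ring
  rw [e]
  field_simp
  push_cast
  ring

/-- The companion of `dihedral_evaluation`: the conjugate functions solve the system shifted by the
exponent `1 / 2`. -/
theorem dihTwist_isPulledSystemAt {x : ℂ} (hP : P₄ x ∈ Complex.slitPlane)
    (hk : k₂Base x ∈ Complex.slitPlane) (hR : R₁ x * R₂ x ∈ Complex.slitPlane) (hQ : Q₄ x ≠ 0)
    (hH : ramPoly x ≠ 0) (hx : x ≠ 0) (hx5 : x - 5 ≠ 0) :
    IsPulledSystemAt coverMult Psi₄ (-5 / 28) (11 / 28) (15 / 28) (1 / 2) (3 / 4)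
      (fun x => Psi₄ x * (dihTwist x * dihFactor₂ x (-sqrtR x)))
      (fun x => 1372 / 15 * (dihTwist x * dihFactor₀ x (-sqrtR x)))
      (fun x => -(4116 / 55) * (dihTwist x * dihFactor₁ x (-sqrtR x))) x := by
  obtain ⟨hR₁, hR₂⟩ := mul_ne_zero_iff.1 (Complex.slitPlane_ne_zero hR)
  have hP0 := Complex.slitPlane_ne_zero hP
  have dw : HasDerivAt (fun x => -sqrtR x) (-sqrtR x * sqrtLogDeriv x) x :=
    (hasDerivAt_sqrtR hR).fun_neg.congr_deriv (by ring)
  have dρ := hasDerivAt_dihTwist hP hk hR hQ hx hx5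
  obtain ⟨h₀, h₁, h₂⟩ := dih_pullOp_relations (w := fun x => -sqrtR x) (σ := -1 / 2)
    (by rw [neg_sq, sqrtR_sq hR₁ hR₂]) dw hR₁ hR₂ hP0 hQ hH hx hx5 dρ
  have hf : DifferentiableAt ℂ (fun x => dihTwist x * dihFactor₂ x (-sqrtR x)) x :=
    dρ.differentiableAt.fun_mul (hasDerivAt_dihFactor₂ hQ hR₁ hP0 dw).differentiableAt
  have hΨ := (hasDerivAt_Psi₄ hP0).differentiableAt
  have hmΨ := coverMult_mul_deriv_Psi₄ hP0 hH
  -- With σ = -1/2 the constants 0, 1/4, 1/2 become 1/2, 3/4, 1. The operator with constant 1,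
  -- applied to the `dihFactor₂` member, is the plain derivation after multiplication by Ψ₄. So the
  -- triple is rotated: that member comes first, and 23/28 drops to -5/28. The relations fix the
  -- scalars 1372/15 and -4116/55.
  norm_num only at h₀ h₁ h₂
  simp only [IsPulledSystemAt, pullOp_const_mul, pullOp_cover_mul hΨ hmΨ hf]
  norm_num only
  refine ⟨?_, ?_, ?_⟩
  · linear_combination 21 / 2 * Psi₄ x * h₂
  · linear_combination -(392 / 3) * h₀
  · linear_combination 274.4 * h₁

theorem dihedral_evaluation_companion : ∀ᶠ x in 𝓝[≠] (0 : ℂ),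
    hyp3F2 ![11 / 28, 15 / 28, 23 / 28] ![3 / 4, 3 / 2] (Psi₄ x) =
      P₄ x ^ (11 / 4 : ℂ) / (Q₄ x ^ 2 * R₁ x) *
        ((sqrtR x - 1 + 15 / 16 * x - 53 / 224 * x ^ 2 + 1 / 56 * x ^ 3) /
          (15 / 64 * x * K₂ x)) := by
  have nn {c : ℂ} (p : ℤ) (q : ℕ) (hc : c = p / q) (hq : q ≠ 0) (h : ¬ (q : ℤ) ∣ p) :
      NotNonposInt c := hc ▸ notNonposInt_div p q hq h
  have aP := analyticAt_P₄ 0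
  have aQ := analyticAt_Q₄ 0
  have aR := analyticAt_R₁ 0
  obtain ⟨f₀, f₁, f₂⟩ := analyticAt_dihFactors analyticAt_sqrtR.fun_neg
  -- At x = 0 with w = -1 the factors `dihFactor₀` and `dihFactor₁` vanish, cancelling the pole of
  -- `dihTwist`; for the `dihFactor₂` member the zero of Ψ₄ does so.
  obtain ⟨g₀, ag₀, hg₀⟩ := exists_analyticAt_eq_mul f₀ (by
    rw [sqrtR_zero, dihFactor₀, dihP]
    norm_num)
  obtain ⟨g₁, ag₁, hg₁⟩ := exists_analyticAt_eq_mul f₁ (by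
    rw [sqrtR_zero, dihFactor₁, R₁_zero]
    norm_num)
  have aG : AnalyticAt ℂ (fun x => P₄ x ^ (11 / 4 : ℂ) * k₂Ext x ^ (-1 / 4 : ℂ) /
      (Q₄ x ^ 2 * R₁ x)) 0 :=
    ((analyticAt_cpow_const aP P₄_zero _).fun_mul
      (analyticAt_cpow_const analyticAt_k₂Ext k₂Ext_zero _)).fun_div ((aQ.fun_pow 2).fun_mul aR)
      (by simp [Q₄_zero, R₁_zero])
  have aS : AnalyticAt ℂ (fun x => -343 / 32 * (R₁ x ^ 2 * Q₄ x ^ 4 / P₄ x ^ 7)) 0 :=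
    analyticAt_const.fun_mul (((aR.fun_pow 2).fun_mul (aQ.fun_pow 4)).fun_div (aP.fun_pow 7)
      (by simp [P₄_zero]))
  have hk := k₂Base_eq_k₂Ext
  have hks : ∀ᶠ x in 𝓝[≠] 0, k₂Base x ∈ Complex.slitPlane := by
    filter_upwards [hk, nhdsWithin_le_nhds (eventually_mem_slitPlane analyticAt_k₂Ext k₂Ext_zero)]
      with x hx hx'
    rwa [hx]
  have hne : ∀ᶠ x : ℂ in 𝓝[≠] 0, x ≠ 0 := self_mem_nhdsWithin
  have E₀ : ∀ᶠ x in 𝓝[≠] 0, -343 / 32 * (R₁ x ^ 2 * Q₄ x ^ 4 / P₄ x ^ 7) *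
      (P₄ x ^ (11 / 4 : ℂ) * k₂Ext x ^ (-1 / 4 : ℂ) / (Q₄ x ^ 2 * R₁ x) *
        dihFactor₂ x (-sqrtR x)) = Psi₄ x * (dihTwist x * dihFactor₂ x (-sqrtR x)) := by
    filter_upwards [hk, hne] with x hx hx0
    rw [dihTwist, hx, Psi₄_eq]
    field_simp
  have E₁ : ∀ᶠ x in 𝓝[≠] 0, 1372 / 15 * (P₄ x ^ (11 / 4 : ℂ) * k₂Ext x ^ (-1 / 4 : ℂ) /
      (Q₄ x ^ 2 * R₁ x) * g₀ x) = 1372 / 15 * (dihTwist x * dihFactor₀ x (-sqrtR x)) := by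
    filter_upwards [hk, hne, nhdsWithin_le_nhds hg₀] with x hx hx0 hg
    rw [dihTwist, hx, hg]
    field_simp
  have E₂ : ∀ᶠ x in 𝓝[≠] 0, -(4116 / 55) * (P₄ x ^ (11 / 4 : ℂ) * k₂Ext x ^ (-1 / 4 : ℂ) /
      (Q₄ x ^ 2 * R₁ x) * g₁ x) = -(4116 / 55) * (dihTwist x * dihFactor₁ x (-sqrtR x)) := by
    filter_upwards [hk, hne, nhdsWithin_le_nhds hg₁] with x hx hx0 hg
    rw [dihTwist, hx, hg]
    field_simp
  -- The operators involve derivatives, so the formulas must agree near each x ≠ 0 and not only at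
  -- x.
  have nh {p : ℂ → Prop} (h : ∀ᶠ x in 𝓝[≠] 0, p x) : ∀ᶠ x in 𝓝[≠] 0, ∀ᶠ y in 𝓝 x, p y :=
    eventually_eventually_nhdsWithin.2 h |>.and hne |>.mono fun x hx => by
      have := hx.1
      rwa [isOpen_compl_singleton.nhdsWithin_eq (show x ∈ ({0}ᶜ : Set ℂ) from hx.2)] at this
  have h := hyp_Psi₄_of_isPulledSystemAt (a₁ := -5 / 28) (a₂ := 11 / 28) (a₃ := 15 / 28)
    (c₁ := 1 / 2) (c₂ := 3 / 4)
    (nn (-5) 28 (by norm_num) (by norm_num) (by norm_num))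
    (nn 11 28 (by norm_num) (by norm_num) (by norm_num))
    (nn 15 28 (by norm_num) (by norm_num) (by norm_num))
    (nn 1 2 (by norm_num) (by norm_num) (by norm_num))
    (nn 3 4 (by norm_num) (by norm_num) (by norm_num))
    (aS.fun_mul (aG.fun_mul f₂)) (analyticAt_const.fun_mul (aG.fun_mul ag₀))
    (analyticAt_const.fun_mul (aG.fun_mul ag₁)) (by
      filter_upwards [nhdsWithin_le_nhds (eventually_mem_slitPlane aP P₄_zero), hks,
        nhdsWithin_le_nhds eventually_R₁_mul_R₂_mem_slitPlane,
        nhdsWithin_le_nhds eventually_Q₄_ne_zero, nhdsWithin_le_nhds eventually_ramPoly_ne_zero,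
        nhdsWithin_le_nhds (eventually_ne_nhds (show (0 : ℂ) ≠ 5 by norm_num)), hne,
        nh E₀, nh E₁, nh E₂] with x hP hk hR hQ hH hx5 hx e₀ e₁ e₂
      exact (dihTwist_isPulledSystemAt hP hk hR hQ hH hx (sub_ne_zero.2 hx5)).congr e₀ e₁ e₂)
  have f0 : dihFactor₂ 0 (-sqrtR 0) = 1 := by
    rw [dihFactor₂, P₄_zero, R₁_zero, Q₄_zero]
    norm_num
  simp only [P₄_zero, R₁_zero, Q₄_zero, k₂Ext_zero, f0, Complex.one_cpow, one_pow, mul_one,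
    div_one] at h
  rw [show (-5 / 28 + 1 : ℂ) = 23 / 28 by norm_num,
    show (1 / 2 + 1 : ℂ) = 3 / 2 by norm_num] at h
  filter_upwards [nhdsWithin_le_nhds h, E₁, hks, hne] with x hx e₁ hk hx0
  have hF := hx.2.1
  rw [e₁, dihTwist, neg_div, Complex.cpow_neg, show k₂Base x ^ (1 / 4 : ℂ) = K₂ x from rfl,
    hyp3F2_rotate, hyp3F2_swap] at hF
  have e : sqrtR x - 1 + 15 / 16 * x - 53 / 224 * x ^ 2 + 1 / 56 * x ^ 3 =
      -2 * dihFactor₀ x (-sqrtR x) := by rw [dihFactor₀, dihP]; ring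
  have hK : K₂ x ≠ 0 := by
    rw [show K₂ x = k₂Base x ^ (1 / 4 : ℂ) from rfl]
    simp [Complex.cpow_eq_zero_iff, Complex.slitPlane_ne_zero hk]
  rw [e]
  -- -343/32 is the value of the first member at 0, namely the leading coefficient of Ψ₄.
  apply mul_left_cancel₀ (show (-343 / 32 : ℂ) ≠ 0 by norm_num)
  rw [← hF]
  field_simp
  ring

end HypergeometricDarboux

end

theorem mainTheorem5 :
    -- the three functions are companions: up to power factors, they are local solutions at `z = 0`
    -- of one and the same hypergeometric equation
    (IsHypSolutionOn ![-3 / 28, 1 / 28, 9 / 28] ![1 / 4, 1 / 2] slitDisc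
        (hyp3F2 ![-3 / 28, 1 / 28, 9 / 28] ![1 / 4, 1 / 2]) ∧
      IsHypSolutionOn ![-3 / 28, 1 / 28, 9 / 28] ![1 / 4, 1 / 2] slitDisc
        (fun z => z ^ (1 / 2 : ℂ) * hyp3F2 ![11 / 28, 15 / 28, 23 / 28] ![3 / 4, 3 / 2] z) ∧
      IsHypSolutionOn ![-3 / 28, 1 / 28, 9 / 28] ![1 / 4, 1 / 2] slitDisc
        (fun z => z ^ (3 / 4 : ℂ) * hyp3F2 ![9 / 14, 11 / 14, 15 / 14] ![5 / 4, 7 / 4] z)) ∧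
    -- the three radical evaluations below concern contiguous functions
    (Contiguous ![-3 / 14, 1 / 14, 9 / 14] ![1 / 4, 3 / 4]
        ![9 / 14, 11 / 14, 15 / 14] ![5 / 4, 7 / 4] ∧
      Contiguous ![-3 / 14, 1 / 14, 9 / 14] ![1 / 4, 3 / 4]
        ![1 / 14, 9 / 14, 11 / 14] ![3 / 4, 5 / 4]) ∧
    -- the two dihedral evaluations
    (∀ᶠ x in 𝓝 (0 : ℂ),
      hyp3F2 ![-3 / 28, 1 / 28, 9 / 28] ![1 / 4, 1 / 2] (Psi₄ x) =
        (1 / 2 * sqrtR x + 1 / 2 - 15 / 32 * x + 53 / 448 * x ^ 2 - 1 / 112 * x ^ 3) /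
          (P₄ x ^ (3 / 4 : ℂ) * K₁ x)) ∧
    (∀ᶠ x in 𝓝[≠] (0 : ℂ),
      hyp3F2 ![11 / 28, 15 / 28, 23 / 28] ![3 / 4, 3 / 2] (Psi₄ x) =
        P₄ x ^ (11 / 4 : ℂ) / (Q₄ x ^ 2 * R₁ x) *
          ((sqrtR x - 1 + 15 / 16 * x - 53 / 224 * x ^ 2 + 1 / 56 * x ^ 3) /
            (15 / 64 * x * K₂ x))) ∧
    -- the radical evaluation of the third companion
    (∀ᶠ x in 𝓝 (0 : ℂ),
      hyp3F2 ![9 / 14, 11 / 14, 15 / 14] ![5 / 4, 7 / 4] (Psi₄ x) =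
        P₄ x ^ (9 / 2 : ℂ) / (Q₄ x ^ 3 * R₁ x ^ (3 / 2 : ℂ)) * (1 - 3 / 14 * x)) ∧
    -- the two further radical evaluations
    (∀ᶠ x in 𝓝 (0 : ℂ),
      hyp3F2 ![1 / 14, 9 / 14, 11 / 14] ![3 / 4, 5 / 4] (Psi₄ x) =
        P₄ x ^ (1 / 2 : ℂ) / (Q₄ x * R₁ x ^ (1 / 2 : ℂ)) *
          (1 - 3 / 5 * x + 1 / 8 * x ^ 2 - 1 / 112 * x ^ 3)) ∧
    (∀ᶠ x in 𝓝 (0 : ℂ),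
      hyp3F2 ![-3 / 14, 1 / 14, 9 / 14] ![1 / 4, 3 / 4] (Psi₄ x) =
        R₁ x ^ (1 / 2 : ℂ) / P₄ x ^ (3 / 2 : ℂ) *
          (1 - 3 / 4 * x + 1 / 4 * x ^ 2 - 3 / 112 * x ^ 3)) :=
  ⟨isHypSolutionOn_companions, contiguous_radical, dihedral_evaluation,
    dihedral_evaluation_companion, radical_evaluations⟩
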